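/- Let $\ell>0$ and $L,D\in\mathbb R$. Consider all $m,n$, all $f:\mathbb R^m\times\mathbb R^n\to\mathbb R$ and all non-empty closed convex bounded sets $\mathcal Y\subset\mathbb R^n$ of diameter at most $D$ such that $f$ is $\ell$-smooth (differentiable with $\ell$-Lipschitz gradient), $f(\cdot,\mathbf y)$ is $L$-Lipschitz for each $\mathbf y\in\mathcal Y$, and $f(\mathbf x,\cdot)$ is concave for each $\mathbf x\in\mathbb R^m$. Put $\Phi(\mathbf x)=\max_{\mathbf y\in\mathcal Y}f(\mathbf x,\mathbf y)$ and let $\Phi_{1/2\ell}(\mathbf x)=\min_{\mathbf w}\{\Phi(\mathbf w)+\ell\|\mathbf w-\mathbf x\|^2\}$ be its Moreau envelope. Call $\mathbf x$ *$\epsilon$-Moreau-stationary* if $\Phi_{1/2\ell}$ is differentiable at $\mathbf x$ and $\|\nabla\Phi_{1/2\ell}(\mathbf x)\|\le\epsilon$, and call $(\mathbf x,\mathbf y)$ an *$\epsilon$-stationary pair* if $$\|\nabla_{\mathbf x}f(\mathbf x,\mathbf y)\|\le\epsilon,\qquad \|\mathcal P_{\mathcal Y}(\mathbf y+(1/\ell)\nabla_{\mathbf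 y}f(\mathbf x,\mathbf y))-\mathbf y\|\le\epsilon/\ell ,$$ where $\mathcal P_{\mathcal Y}$ is the Euclidean projection onto $\mathcal Y$. 1. (Extragradient.) There is a constant $C>0$ depending only on $\ell,L,D$ such that for every $\epsilon>0$ there are a stepsize $\eta>0$ and an iteration budget $T$ (depending only on $\ell,L,D,\epsilon$) with the following property. If $\hat{\mathbf x}$ is $\epsilon$-Moreau-stationary and $\mathbf y_0\in\mathcal Y$, then the extragradient method with stepsize $\eta$ and at most $T$ iterations for the problem $\min_{\mathbf x}\max_{\mathbf y\in\mathcal Y}f(\mathbf x,\mathbf y)+\ell\|\mathbf x-\hat{\mathbf x}\|^2$, started at $(\hat{\mathbf x},\mathbf y_0)$ and stopped at the first extrapolated point that is a $C\epsilon$-stationary pair, uses at most $C\epsilon^{-2}$ evaluations of $\nabla f$ and returns a $C\epsilon$-stationary pair $(\mathbf x',\mathbf y')$ with $\mathbf y'\in\mathcal Y$. 2. (Stochastic mirror-prox.) For every $\sigma\ge0$ there is a constant $C>0$ depending only on $\ell,L,D,\sigma$ such that for every $\epsilon>0$ there are $\eta>0$ and $T$ (depending only on $\ell,L,D,\sigma,\epsilon$)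 with the following property. Let $G$ be a stochastic gradient oracle with $\mathbb E[G(\mathbf x,\mathbf y,\xi)-\nabla f(\mathbf x,\mathbf y)]=0$ and $\mathbb E\|G(\mathbf x,\mathbf y,\xi)-\nabla f(\mathbf x,\mathbf y)\|^2\le\sigma^2$ at all points, queried with i.i.d. samples. If $\hat{\mathbf x}$ is $\epsilon$-Moreau-stationary and $\mathbf y_0\in\mathcal Y$, then $T$ iterations of (Euclidean) stochastic mirror-prox with stepsize $\eta$ on the same regularized problem, started at $(\hat{\mathbf x},\mathbf y_0)$ and returning the average of the extrapolated points (the starting point if $T=0$), use at most $C\epsilon^{-4}$ stochastic gradients and return $(\mathbf x',\mathbf y')$ with $\mathbf y'\in\mathcal Y$ that is a $C\epsilon$-stationary pair in mean square: $$\mathbb E\|\nabla_{\mathbf x}f(\mathbf x',\mathbf y')\|^2\le (C\epsilon)^2,\qquad \mathbb E\|\mathcal P_{\mathcal Y}(\mathbf y'+(1/\ell)\nabla_{\mathbf y}f(\mathbf x',\mathbf y'))-\mathbf y'\|^2\le (C\epsilon/\ell)^2 .$$ 3. (Converse.) There is a constant $C>0$ depending only on $\ell,L,D$ such that for every $\epsilon\ge0$: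 if $(\hat{\mathbf x},\hat{\mathbf y})\in\mathbb R^m\times\mathbb R^n$ is an $\epsilon^2$-stationary pair, then $\hat{\mathbf x}$ is $C\epsilon$-Moreau-stationary. -/

import Mathlib

open MeasureTheory ProbabilityTheory
open scoped Gradient

noncomputable section

namespace Minimax

/-- The space `ℝᵐ⁺ⁿ = ℝᵐ × ℝⁿ` with its Euclidean (`ℓ₂`) norm. -/
abbrev Z (m n : ℕ) : Type :=
  WithLp 2 (EuclideanSpace ℝ (Fin m) × EuclideanSpace ℝ (Fin n))

/-- The point `(x, y)` of `ℝᵐ⁺ⁿ`. -/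
abbrev mk {m n : ℕ} (x : EuclideanSpace ℝ (Fin m)) (y : EuclideanSpace ℝ (Fin n)) : Z m n :=
  WithLp.toLp 2 (x, y)

/-- The partial gradient `∇ₓ f (x, y)`, the first block of `∇ f (x, y)`. -/
def gradX {m n : ℕ} (f : Z m n → ℝ) (z : Z m n) : EuclideanSpace ℝ (Fin m) := (∇ f z).fst

/-- The partial gradient `∇_y f (x, y)`, the second block of `∇ f (x, y)`. -/
def gradY {m n : ℕ} (f : Z m n → ℝ) (z : Z m n) : EuclideanSpace ℝ (Fin n) := (∇ f z).snd

/-- A function is `ℓ`-smooth if it is differentiable with `ℓ`-Lipschitz gradient. -/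
def IsSmooth {m n : ℕ} (ℓ : ℝ) (f : Z m n → ℝ) : Prop :=
  Differentiable ℝ f ∧ ∀ z z' : Z m n, ‖∇ f z - ∇ f z'‖ ≤ ℓ * ‖z - z'‖

/-- The nonconvex-concave setting. Closedness and non-emptiness of `𝒴` are what makes the maximum
over `𝒴` and the Euclidean projection onto `𝒴` meaningful. -/
structure NonconvexConcave {m n : ℕ} (f : Z m n → ℝ) (𝒴 : Set (EuclideanSpace ℝ (Fin n)))
    (ℓ L D : ℝ) : Prop where
  smooth : IsSmooth ℓ f
  lipschitz : ∀ y ∈ 𝒴, ∀ x x' : EuclideanSpace ℝ (Fin m),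
    ‖f (mk x y) - f (mk x' y)‖ ≤ L * ‖x - x'‖
  concave : ∀ x : EuclideanSpace ℝ (Fin m), ConcaveOn ℝ Set.univ fun y => f (mk x y)
  nonempty : 𝒴.Nonempty
  closed : IsClosed 𝒴
  convex : Convex ℝ 𝒴
  bounded : Bornology.IsBounded 𝒴
  diam_le : Metric.diam 𝒴 ≤ D

/-- `Φ(x) = max_{y ∈ 𝒴} f (x, y)`. -/
def primal {m n : ℕ} (f : Z m n → ℝ) (𝒴 : Set (EuclideanSpace ℝ (Fin n)))
    (x : EuclideanSpace ℝ (Fin m)) : ℝ :=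
  sSup ((fun y => f (mk x y)) '' 𝒴)

/-- The Moreau envelope `Φ_lam(x) = min_w Φ(w) + (1 / (2 lam)) ‖w - x‖²`. -/
def moreau {m : ℕ} (Φ : EuclideanSpace ℝ (Fin m) → ℝ) (lam : ℝ)
    (x : EuclideanSpace ℝ (Fin m)) : ℝ :=
  ⨅ w, (Φ w + 1 / (2 * lam) * ‖w - x‖ ^ 2)

/-- `x` is an `ε`-stationary point of `Φ` in the Moreau-envelope sense: `Φ_{1/(2ℓ)}` is
differentiable at `x` and its gradient there has norm at most `ε`. -/
def IsMoreauStationary {m : ℕ} (ℓ : ℝ) (Φ : EuclideanSpace ℝ (Fin m) → ℝ) (ε : ℝ)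
    (x : EuclideanSpace ℝ (Fin m)) : Prop :=
  DifferentiableAt ℝ (moreau Φ (1 / (2 * ℓ))) x ∧ ‖∇ (moreau Φ (1 / (2 * ℓ))) x‖ ≤ ε

open Classical in
/-- The Euclidean projection: a nearest point of `𝒴` to `y` (unique and existing when `𝒴` is
non-empty, closed and convex; the value is `y` if there is no nearest point). -/
def proj {n : ℕ} (𝒴 : Set (EuclideanSpace ℝ (Fin n))) (y : EuclideanSpace ℝ (Fin n)) :
    EuclideanSpace ℝ (Fin n) :=
  if h : ∃ p ∈ 𝒴, ∀ q ∈ 𝒴, ‖y - p‖ ≤ ‖y - q‖ then h.choose else y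

/-- The displacement `P_𝒴(y + (1/ℓ) v) - y`; with `v = ∇_y f (x, y)` it measures stationarity
in `y`. -/
def gradMap {n : ℕ} (𝒴 : Set (EuclideanSpace ℝ (Fin n))) (ℓ : ℝ)
    (y v : EuclideanSpace ℝ (Fin n)) : EuclideanSpace ℝ (Fin n) :=
  proj 𝒴 (y + (1 / ℓ) • v) - y

/-- `z = (x, y)` is an `ε`-stationary pair. -/
def IsStationaryPair {m n : ℕ} (f : Z m n → ℝ) (𝒴 : Set (EuclideanSpace ℝ (Fin n)))
    (ℓ ε : ℝ) (z : Z m n) : Prop :=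
  ‖gradX f z‖ ≤ ε ∧ ‖gradMap 𝒴 ℓ z.snd (gradY f z)‖ ≤ ε / ℓ

/-! ### First-order algorithms with a count of oracle calls -/

/-- A first-order algorithm on `E`: it either stops with an output, or queries the (stochastic)
gradient oracle at a point and continues depending on the answer. -/
inductive FirstOrder (E : Type) : Type
  | ret : E → FirstOrder E
  | query : E → (E → FirstOrder E) → FirstOrder E

/-- Run an algorithm when the `j`-th oracle call at the point `z` is answered by `O j z` and `k`
calls have been made so far. Returns the output and the total number of oracle calls. -/
def FirstOrder.runFrom {E : Type} (O : ℕ → E → E) : FirstOrder E → ℕ → E × ℕ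
  | .ret z, k => (z, k)
  | .query z cont, k => FirstOrder.runFrom O (cont (O k z)) (k + 1)

/-- The output of an algorithm. -/
def FirstOrder.output {E : Type} (O : ℕ → E → E) (A : FirstOrder E) : E := (A.runFrom O 0).1

/-- The number of oracle calls that an algorithm makes. -/
def FirstOrder.calls {E : Type} (O : ℕ → E → E) (A : FirstOrder E) : ℕ := (A.runFrom O 0).2

/-- A projected descent-ascent step of size `η` from `z` for the regularized problem
`min_x max_{y ∈ 𝒴} f (x, y) + ℓ ‖x - xhat‖²`, where `g` is the (stochastic) gradient of `f` at
the point `w`, and `2 ℓ (w.fst - xhat)` is the gradient of the regularizer. -/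
def step {m n : ℕ} (𝒴 : Set (EuclideanSpace ℝ (Fin n))) (ℓ : ℝ) (xhat : EuclideanSpace ℝ (Fin m))
    (η : ℝ) (z w g : Z m n) : Z m n :=
  mk (z.fst - η • (g.fst + (2 * ℓ) • (w.fst - xhat))) (proj 𝒴 (z.snd + η • g.snd))

open Classical in
/-- The extragradient algorithm for the regularized problem, with at most `T` iterations of two
gradient evaluations each. It stops at the first extrapolated point `w` whose gradient `h` passes
the test of `δ`-stationarity. -/
def extragradient {m n : ℕ} (𝒴 : Set (EuclideanSpace ℝ (Fin n))) (ℓ : ℝ)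
    (xhat : EuclideanSpace ℝ (Fin m)) (η δ : ℝ) : ℕ → Z m n → FirstOrder (Z m n)
  | 0, z => .ret z
  | T + 1, z =>
    .query z fun g =>
      let w := step 𝒴 ℓ xhat η z z g
      .query w fun h =>
        if ‖h.fst‖ ≤ δ ∧ ‖gradMap 𝒴 ℓ w.snd h.snd‖ ≤ δ / ℓ then .ret w
        else extragradient 𝒴 ℓ xhat η δ T (step 𝒴 ℓ xhat η z w h)

/-- The loop of stochastic mirror-prox: `T` further iterations from `z`, where `s` is the sum of
the extrapolated points so far; the output is `c • s` for the final sum. -/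
def mirrorProxLoop {m n : ℕ} (𝒴 : Set (EuclideanSpace ℝ (Fin n))) (ℓ : ℝ)
    (xhat : EuclideanSpace ℝ (Fin m)) (η c : ℝ) : ℕ → Z m n → Z m n → FirstOrder (Z m n)
  | 0, _, s => .ret (c • s)
  | T + 1, z, s =>
    .query z fun g =>
      let w := step 𝒴 ℓ xhat η z z g
      .query w fun h => mirrorProxLoop 𝒴 ℓ xhat η c T (step 𝒴 ℓ xhat η z w h) (s + w)

/-- Stochastic mirror-prox (Euclidean setup) for the regularized problem: `T` iterations of two
stochastic gradients each, and the average of the extrapolated points as output (the starting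
point if `T = 0`). -/
def mirrorProx {m n : ℕ} (𝒴 : Set (EuclideanSpace ℝ (Fin n))) (ℓ : ℝ)
    (xhat : EuclideanSpace ℝ (Fin m)) (η : ℝ) (T : ℕ) (z : Z m n) : FirstOrder (Z m n) :=
  if T = 0 then .ret z else mirrorProxLoop 𝒴 ℓ xhat η (1 / (T : ℝ)) T z 0

/-- `G` is a stochastic gradient oracle for `f`, driven by samples of law `ν`: it is unbiased and
its variance is at most `σ²`, at every point. -/
structure IsStochasticOracle {m n : ℕ} {Ξ : Type*} [MeasurableSpace Ξ] (ν : Measure Ξ)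
    (f : Z m n → ℝ) (σ : ℝ) (G : Z m n → Ξ → Z m n) : Prop where
  measurable : Measurable fun p : Z m n × Ξ => G p.1 p.2
  integrable : ∀ z, Integrable (fun s => G z s - ∇ f z) ν
  unbiased : ∀ z, ∫ s, (G z s - ∇ f z) ∂ν = 0
  integrable_sq : ∀ z, Integrable (fun s => ‖G z s - ∇ f z‖ ^ 2) ν
  variance_le : ∀ z, ∫ s, ‖G z s - ∇ f z‖ ^ 2 ∂ν ≤ σ ^ 2

end Minimax

end

noncomputable section

namespace Minimax

open Filter Topology RealInnerProductSpace

/-! ### Smooth functions on a Hilbert space -/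

section Hilbert

variable {E : Type*} [NormedAddCommGroup E] [InnerProductSpace ℝ E] [CompleteSpace E]

/-! Since `f` is `ℓ`-weakly convex in `x`, the regularized objective `f (x, y) + ℓ ‖x - xhat‖²` is
`ℓ`-strongly convex in `x` and concave in `y`. It has a saddle point `(x, y)`, whose `x` is the
proximal point of `Φ` at `xhat`. The Moreau envelope then has gradient `2 ℓ (xhat - x)`, so Moreau
stationarity says exactly `2 ℓ ‖x - xhat‖ ≤ ε` (`exists_isSaddle`,
`IsSaddle.isMoreauStationary_iff`). All three claims become statements about this saddle point.

Extragradient: each iteration lowers the squared distance to the saddle point by a multiple of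
`‖w.fst - x‖² + ‖w - z‖²` (`IsSaddle.extragradient_descent`). If both terms are small, the
extrapolated point `w` passes the stationarity test (`isStationaryPair_of_close`). Hence each failed
test costs order `ε²` of an initial squared distance bounded in terms of `ℓ`, `L`, `D`, and order
`ε⁻²` iterations suffice.

Mirror-prox: a small duality gap of the average controls the squares of both stationarity measures
(`stationarity_of_gap`). On every sample path the gap is at most a quantity that does not depend on
the comparison point (`gap_le_gapBound`); its mean is at most `R² / (η T) + 7/2 η σ²`, because the
errors are orthogonal to the past (`integral_gapBound_le`). Taking `η` of order `ε²` and `T` of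
order `ε⁻⁴` makes this of order `ε²`.

Converse: comparing the values at the given pair and at the saddle point gives `ℓ r² ≤ 2 ε² (r +
|D|)` for `r = ‖x - xhat‖`, where `r ≤ |L| / (2 ℓ)` a priori; so `r` is of order `ε`. -/

theorem hasDerivAt_line {f : E → ℝ} (hf : Differentiable ℝ f) (z d : E) (t : ℝ) :
    HasDerivAt (fun s : ℝ => f (z + s • d)) ⟪∇ f (z + t • d), d⟫ t := by
  have h1 : HasFDerivAt f (fderiv ℝ f (z + t • d)) (z + t • d) := (hf _).hasFDerivAt
  have h2 : HasDerivAt (fun s : ℝ => z + s • d) d t := by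
    simpa using ((hasDerivAt_id t).smul_const d).const_add z
  have h3 := h1.comp_hasDerivAt t h2
  rwa [← inner_gradient_left] at h3

/-- The lower half of the descent lemma. -/
theorem descent_lower {f : E → ℝ} {ℓ : ℝ} (hf : Differentiable ℝ f)
    (hl : ∀ z z' : E, ‖∇ f z - ∇ f z'‖ ≤ ℓ * ‖z - z'‖) (z d : E) :
    f z + ⟪∇ f z, d⟫ - ℓ / 2 * ‖d‖ ^ 2 ≤ f (z + d) := by
  -- The added quadratic compensates the Lipschitz variation of the gradient, so this function of
  -- the line parameter is monotone on `[0, 1]`; its endpoint values give the bound.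
  have hd : ∀ t : ℝ, HasDerivAt
      (fun s : ℝ => f (z + s • d) - s * ⟪∇ f z, d⟫ + ℓ / 2 * ‖d‖ ^ 2 * s ^ 2)
      (⟪∇ f (z + t • d), d⟫ - ⟪∇ f z, d⟫ + ℓ * ‖d‖ ^ 2 * t) t := by
    intro t
    have := ((hasDerivAt_line hf z d t).sub ((hasDerivAt_id t).mul_const ⟪∇ f z, d⟫)).add
      (((hasDerivAt_id t).pow 2).const_mul (ℓ / 2 * ‖d‖ ^ 2))
    refine this.congr_deriv ?_
    simp
    ring
  have hmono := monotoneOn_of_deriv_nonneg (convex_Icc (0 : ℝ) 1)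
    (fun t _ => (hd t).continuousAt.continuousWithinAt)
    (fun t _ => (hd t).differentiableAt.differentiableWithinAt)
    (by
      intro t ht
      rw [interior_Icc] at ht
      rw [(hd t).deriv, ← inner_sub_left]
      have h1 := abs_real_inner_le_norm (∇ f (z + t • d) - ∇ f z) d
      have h2 := hl (z + t • d) z
      rw [add_sub_cancel_left, norm_smul, Real.norm_of_nonneg ht.1.le] at h2
      have h3 := neg_abs_le ⟪∇ f (z + t • d) - ∇ f z, d⟫
      have h4 := mul_le_mul_of_nonneg_right h2 (norm_nonneg d)
      nlinarith)
  have := hmono (Set.left_mem_Icc.2 zero_le_one) (Set.right_mem_Icc.2 zero_le_one) zero_le_one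
  simp [-inner_gradient_left] at this
  linarith

/-- The first-order upper bound of a concave function along a line. -/
theorem concave_line_upper {φ : ℝ → ℝ} (hφ : ConcaveOn ℝ Set.univ φ) {φ' : ℝ}
    (hd : HasDerivAt φ φ' 0) : φ 1 ≤ φ 0 + φ' := by
  have := hφ.slope_le_of_hasDerivAt (Set.mem_univ 0) (Set.mem_univ 1) zero_lt_one hd
  rw [slope_def_field] at this
  linarith

end Hilbert

/-! ### The product structure -/

section Product

variable {m n : ℕ}

theorem inner_Z (a b : Z m n) : ⟪a, b⟫ = ⟪a.fst, b.fst⟫ + ⟪a.snd, b.snd⟫ :=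
  WithLp.prod_inner_apply a b

theorem norm_sq_Z (a : Z m n) : ‖a‖ ^ 2 = ‖a.fst‖ ^ 2 + ‖a.snd‖ ^ 2 :=
  WithLp.prod_norm_sq_eq_of_L2 a

theorem norm_fst_le (a : Z m n) : ‖a.fst‖ ≤ ‖a‖ :=
  (sq_le_sq₀ (norm_nonneg _) (norm_nonneg _)).1 (by nlinarith [norm_sq_Z a, sq_nonneg ‖a.snd‖])

theorem norm_snd_le (a : Z m n) : ‖a.snd‖ ≤ ‖a‖ :=
  (sq_le_sq₀ (norm_nonneg _) (norm_nonneg _)).1 (by nlinarith [norm_sq_Z a, sq_nonneg ‖a.fst‖])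

theorem norm_le_add (a : Z m n) : ‖a‖ ≤ ‖a.fst‖ + ‖a.snd‖ := by
  refine (sq_le_sq₀ (norm_nonneg _) (by positivity)).1 ?_
  nlinarith [norm_sq_Z a, norm_nonneg a.fst, norm_nonneg a.snd,
    mul_nonneg (norm_nonneg a.fst) (norm_nonneg a.snd)]

theorem mk_add_fst (x d : EuclideanSpace ℝ (Fin m)) (y : EuclideanSpace ℝ (Fin n)) :
    mk (x + d) y = mk x y + mk d 0 := by
  change WithLp.toLp 2 (x + d, y) = WithLp.toLp 2 ((x, y) + (d, 0))
  rw [Prod.mk_add_mk, add_zero]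

theorem mk_add_snd (x : EuclideanSpace ℝ (Fin m)) (y d : EuclideanSpace ℝ (Fin n)) :
    mk x (y + d) = mk x y + mk 0 d := by
  change WithLp.toLp 2 (x, y + d) = WithLp.toLp 2 ((x, y) + (0, d))
  rw [Prod.mk_add_mk, add_zero]

theorem norm_mk_fst (d : EuclideanSpace ℝ (Fin m)) : ‖(mk d 0 : Z m n)‖ = ‖d‖ := by
  simp

theorem norm_mk_snd (d : EuclideanSpace ℝ (Fin n)) : ‖(mk 0 d : Z m n)‖ = ‖d‖ := by
  simp

end Product

/-! ### Projection onto a closed convex set -/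

section Projection

variable {n : ℕ} {𝒴 : Set (EuclideanSpace ℝ (Fin n))}

/-- The variational inequality is the only form in which the projection is used; `proj` is not
unfolded again. -/
theorem proj_spec (hne : 𝒴.Nonempty) (hcl : IsClosed 𝒴) (hcv : Convex ℝ 𝒴)
    (y : EuclideanSpace ℝ (Fin n)) :
    proj 𝒴 y ∈ 𝒴 ∧ ∀ q ∈ 𝒴, ⟪y - proj 𝒴 y, q - proj 𝒴 y⟫ ≤ 0 := by
  have hex : ∃ p ∈ 𝒴, ∀ q ∈ 𝒴, ‖y - p‖ ≤ ‖y - q‖ := by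
    obtain ⟨p, hp, h⟩ := hcl.exists_infDist_eq_dist hne y
    refine ⟨p, hp, fun q hq => ?_⟩
    rw [← dist_eq_norm, ← dist_eq_norm, ← h]
    exact Metric.infDist_le_dist_of_mem hq
  have hp : proj 𝒴 y = hex.choose := dif_pos hex
  obtain ⟨h1, h2⟩ := hex.choose_spec
  rw [← hp] at h1 h2
  refine ⟨h1, (norm_eq_iInf_iff_real_inner_le_zero hcv h1).1 ?_⟩
  have : Nonempty 𝒴 := ⟨⟨_, h1⟩⟩
  refine le_antisymm (le_ciInf fun q => h2 q q.2) ?_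
  exact ciInf_le ⟨0, by rintro _ ⟨q, rfl⟩; exact norm_nonneg _⟩ (⟨_, h1⟩ : 𝒴)

theorem norm_proj_sub_le (hne : 𝒴.Nonempty) (hcl : IsClosed 𝒴) (hcv : Convex ℝ 𝒴)
    (y y' : EuclideanSpace ℝ (Fin n)) : ‖proj 𝒴 y - proj 𝒴 y'‖ ≤ ‖y - y'‖ := by
  obtain ⟨h1, h2⟩ := proj_spec hne hcl hcv y
  obtain ⟨h1', h2'⟩ := proj_spec hne hcl hcv y'
  have e1 := h2 _ h1'
  have e2 := h2' _ h1
  set p := proj 𝒴 y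
  set p' := proj 𝒴 y'
  have e3 : ‖p - p'‖ ^ 2 ≤ ⟪y - y', p - p'⟫ := by
    rw [← real_inner_self_eq_norm_sq]
    have a1 : ⟪y - y', p - p'⟫ - ⟪p - p', p - p'⟫ =
        -⟪y - p, p' - p⟫ - ⟪y' - p', p - p'⟫ := by
      simp only [inner_sub_left, inner_sub_right]; ring
    linarith
  have e4 := real_inner_le_norm (y - y') (p - p')
  by_contra! hlt
  have : 0 < ‖p - p'‖ := lt_of_le_of_lt (norm_nonneg _) hlt
  nlinarith

theorem continuous_proj (hne : 𝒴.Nonempty) (hcl : IsClosed 𝒴) (hcv : Convex ℝ 𝒴) :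
    Continuous (proj 𝒴) := by
  refine (LipschitzWith.of_dist_le_mul (K := 1) fun y y' => ?_).continuous
  simpa [dist_eq_norm] using norm_proj_sub_le hne hcl hcv y y'

/-- The length of a projected step grows at most linearly with the stepsize. -/
theorem norm_proj_step_le (hne : 𝒴.Nonempty) (hcl : IsClosed 𝒴) (hcv : Convex ℝ 𝒴)
    (z v : EuclideanSpace ℝ (Fin n)) {η s : ℝ} (hη : 0 < η) (hs : η ≤ s) :
    ‖proj 𝒴 (z + s • v) - z‖ ≤ s / η * ‖proj 𝒴 (z + η • v) - z‖ := by
  obtain ⟨h1, h2⟩ := proj_spec hne hcl hcv (z + η • v)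
  obtain ⟨h1', h2'⟩ := proj_spec hne hcl hcv (z + s • v)
  have e1 := h2 _ h1'
  have e2 := h2' _ h1
  set p := proj 𝒴 (z + η • v)
  set q := proj 𝒴 (z + s • v)
  obtain ⟨a, ha⟩ : ∃ a, a = p - z := ⟨_, rfl⟩
  obtain ⟨b, hb⟩ : ∃ b, b = q - z := ⟨_, rfl⟩
  have i1 : z + η • v - p = η • v - a := by rw [ha]; abel
  have i2 : z + s • v - q = s • v - b := by rw [hb]; abel
  have i3 : q - p = b - a := by rw [ha, hb]; abel
  have i4 : p - q = a - b := by rw [ha, hb]; abel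
  rw [i1, i3] at e1
  rw [i2, i4] at e2
  rw [← ha, ← hb]
  simp only [inner_sub_left, inner_sub_right, real_inner_smul_left,
    real_inner_self_eq_norm_sq, real_inner_comm a b] at e1 e2
  have e3 := real_inner_le_norm a b
  have hs0 : 0 < s := hη.trans_le hs
  rw [div_mul_eq_mul_div, le_div_iff₀ hη]
  -- Weighting the two variational inequalities by `s` and `η` eliminates `v`. With Cauchy-Schwarz
  -- the result factors as `(‖b‖ - ‖a‖) (η ‖b‖ - s ‖a‖) ≤ 0`.
  have e4 : η * ‖b‖ ^ 2 + s * ‖a‖ ^ 2 ≤ (s + η) * (‖a‖ * ‖b‖) := by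
    have f1 := mul_le_mul_of_nonneg_left e1 hs0.le
    have f2 := mul_le_mul_of_nonneg_left e2 hη.le
    have f3 := mul_le_mul_of_nonneg_left e3 (by positivity : 0 ≤ s + η)
    nlinarith
  by_contra! hlt
  have hab : ‖a‖ < ‖b‖ := by
    have := mul_le_mul_of_nonneg_right hs (norm_nonneg a)
    nlinarith
  nlinarith [mul_pos (sub_pos.2 hab) (sub_pos.2 hlt)]

end Projection

/-! ### Partial gradients and the regularized objective -/

theorem continuous_of_differentiable {E : Type*} [NormedAddCommGroup E] [InnerProductSpace ℝ E]
    {f : E → ℝ} (hf : Differentiable ℝ f) : Continuous f :=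
  hf.continuous

section Smooth

variable {m n : ℕ} {f : Z m n → ℝ} {ℓ : ℝ}

theorem gradX_sub_le (hf : IsSmooth ℓ f) (z z' : Z m n) :
    ‖gradX f z - gradX f z'‖ ≤ ℓ * ‖z - z'‖ := by
  have := norm_fst_le (∇ f z - ∇ f z')
  rw [WithLp.sub_fst] at this
  exact this.trans (hf.2 z z')

theorem gradY_sub_le (hf : IsSmooth ℓ f) (z z' : Z m n) :
    ‖gradY f z - gradY f z'‖ ≤ ℓ * ‖z - z'‖ := by
  have := norm_snd_le (∇ f z - ∇ f z')
  rw [WithLp.sub_snd] at this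
  exact this.trans (hf.2 z z')

theorem continuous_gradient (hℓ : 0 < ℓ) (hf : IsSmooth ℓ f) : Continuous (∇ f) := by
  refine (LipschitzWith.of_dist_le_mul (K := ⟨ℓ, hℓ.le⟩) fun z z' => ?_).continuous
  rw [dist_eq_norm, dist_eq_norm]
  exact hf.2 z z'

theorem weaklyConvex_lower (hf : IsSmooth ℓ f) (x x' : EuclideanSpace ℝ (Fin m))
    (y : EuclideanSpace ℝ (Fin n)) :
    f (mk x y) + ⟪gradX f (mk x y), x' - x⟫ - ℓ / 2 * ‖x' - x‖ ^ 2 ≤ f (mk x' y) := by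
  have := descent_lower hf.1 hf.2 (mk x y) (mk (x' - x) 0)
  rw [← mk_add_fst, add_sub_cancel, norm_mk_fst, inner_Z] at this
  simpa [gradX, -inner_gradient_left] using this

theorem smooth_lower_snd (hf : IsSmooth ℓ f) (x : EuclideanSpace ℝ (Fin m))
    (y y' : EuclideanSpace ℝ (Fin n)) :
    f (mk x y) + ⟪gradY f (mk x y), y' - y⟫ - ℓ / 2 * ‖y' - y‖ ^ 2 ≤ f (mk x y') := by
  have := descent_lower hf.1 hf.2 (mk x y) (mk 0 (y' - y))
  rw [← mk_add_snd, add_sub_cancel, norm_mk_snd, inner_Z] at this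
  simpa [gradY, -inner_gradient_left] using this

theorem concave_upper (hf : Differentiable ℝ f) {x : EuclideanSpace ℝ (Fin m)}
    (hc : ConcaveOn ℝ Set.univ fun y => f (mk x y)) (y y' : EuclideanSpace ℝ (Fin n)) :
    f (mk x y') ≤ f (mk x y) + ⟪gradY f (mk x y), y' - y⟫ := by
  have h1 := hasDerivAt_line hf (mk x y) (mk 0 (y' - y)) 0
  have h2 : ∀ s : ℝ, mk x y + s • (mk 0 (y' - y) : Z m n) = mk x (AffineMap.lineMap y y' s) := by
    intro s
    rw [AffineMap.lineMap_apply_module', add_comm _ y, mk_add_snd]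
    congr 1
    change WithLp.toLp 2 (s • ((0 : EuclideanSpace ℝ (Fin m)), y' - y)) = _
    simp [mk]
  simp only [h2] at h1
  have h3 := concave_line_upper
    (hc.comp_affineMap (AffineMap.lineMap y y')) h1
  rw [inner_Z] at h3
  simpa [gradY, Function.comp_def, -inner_gradient_left] using h3

/-- The regularized objective `f (x, y) + ℓ ‖x - xhat‖²`. -/
def reg (f : Z m n → ℝ) (ℓ : ℝ) (xhat : EuclideanSpace ℝ (Fin m)) (x : EuclideanSpace ℝ (Fin m))
    (y : EuclideanSpace ℝ (Fin n)) : ℝ :=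
  f (mk x y) + ℓ * ‖x - xhat‖ ^ 2

/-- The gradient of the regularized objective in `x`. -/
def regGradX (f : Z m n → ℝ) (ℓ : ℝ) (xhat : EuclideanSpace ℝ (Fin m))
    (x : EuclideanSpace ℝ (Fin m)) (y : EuclideanSpace ℝ (Fin n)) : EuclideanSpace ℝ (Fin m) :=
  gradX f (mk x y) + (2 * ℓ) • (x - xhat)

/-- Smoothness costs curvature `ℓ` and the regularizer supplies `2 ℓ`, which leaves strong convexity
of modulus `ℓ` in `x`. -/
theorem reg_lower (hf : IsSmooth ℓ f) (xhat x x' : EuclideanSpace ℝ (Fin m))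
    (y : EuclideanSpace ℝ (Fin n)) :
    reg f ℓ xhat x y + ⟪regGradX f ℓ xhat x y, x' - x⟫ + ℓ / 2 * ‖x' - x‖ ^ 2 ≤
      reg f ℓ xhat x' y := by
  have h := weaklyConvex_lower hf x x' y
  have e : ‖x' - xhat‖ ^ 2 = ‖x' - x‖ ^ 2 + 2 * ⟪x - xhat, x' - x⟫ + ‖x - xhat‖ ^ 2 := by
    have : x' - xhat = (x' - x) + (x - xhat) := by abel
    rw [this, norm_add_sq_real, real_inner_comm]
  rw [reg, reg, regGradX, e, inner_add_left, real_inner_smul_left]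
  nlinarith

theorem reg_concave_upper (hf : Differentiable ℝ f) {x : EuclideanSpace ℝ (Fin m)}
    (hc : ConcaveOn ℝ Set.univ fun y => f (mk x y)) (xhat : EuclideanSpace ℝ (Fin m))
    (y y' : EuclideanSpace ℝ (Fin n)) :
    reg f ℓ xhat x y' ≤ reg f ℓ xhat x y + ⟪gradY f (mk x y), y' - y⟫ := by
  have := concave_upper hf hc y y'
  rw [reg, reg]
  linarith

/-- The equation is the fixed-point equation of `x ↦ xhat - (1 / (2 ℓ)) ∇ₓ f (x, y)`, a contraction
of ratio `1 / 2`. -/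
theorem exists_regGradX_eq_zero (hℓ : 0 < ℓ) (hf : IsSmooth ℓ f)
    (xhat : EuclideanSpace ℝ (Fin m)) (y : EuclideanSpace ℝ (Fin n)) :
    ∃ x, regGradX f ℓ xhat x y = 0 := by
  have hc : ContractingWith (1 / 2) fun x => xhat - (1 / (2 * ℓ)) • gradX f (mk x y) := by
    refine ⟨by rw [← NNReal.coe_lt_coe]; norm_num, LipschitzWith.of_dist_le_mul fun x x' => ?_⟩
    rw [dist_eq_norm, dist_eq_norm, sub_sub_sub_cancel_left, ← smul_sub, norm_smul]
    have h := gradX_sub_le hf (mk x' y) (mk x y)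
    have e : (mk x' y : Z m n) - mk x y = mk (x' - x) 0 := by
      rw [sub_eq_iff_eq_add', ← mk_add_fst, add_sub_cancel]
    rw [e, norm_mk_fst, norm_sub_rev x'] at h
    rw [Real.norm_of_nonneg (by positivity)]
    calc _ ≤ 1 / (2 * ℓ) * (ℓ * ‖x - x'‖) := by gcongr
      _ = _ := by push_cast; field_simp
  have h := hc.fixedPoint_isFixedPt
  set x := hc.fixedPoint
  refine ⟨x, ?_⟩
  have h' : xhat - (1 / (2 * ℓ)) • gradX f (mk x y) = x := h
  have : x - xhat = -((1 / (2 * ℓ)) • gradX f (mk x y)) := by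
    nth_rewrite 1 [← h']; abel
  rw [regGradX, this, smul_neg, smul_smul, mul_one_div_cancel (by positivity), one_smul,
    add_neg_cancel]

/-- The minimizer of the regularized objective in `x` moves at most as fast as `y`. -/
theorem norm_minimizer_sub_le (hℓ : 0 < ℓ) (hf : IsSmooth ℓ f)
    {xhat x x' : EuclideanSpace ℝ (Fin m)} {y y' : EuclideanSpace ℝ (Fin n)}
    (h : regGradX f ℓ xhat x y = 0) (h' : regGradX f ℓ xhat x' y' = 0) :
    ‖x - x'‖ ≤ ‖y - y'‖ := by
  have e : (2 * ℓ) • (x - x') = -(gradX f (mk x y) - gradX f (mk x' y')) := by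
    rw [regGradX] at h h'
    have a1 := eq_neg_of_add_eq_zero_right h
    have a2 := eq_neg_of_add_eq_zero_right h'
    have : x - x' = (x - xhat) - (x' - xhat) := by abel
    rw [this, smul_sub, a1, a2]; abel
  have e2 : 2 * ℓ * ‖x - x'‖ ≤ ℓ * ‖(mk x y : Z m n) - mk x' y'‖ := by
    have := congrArg norm e
    rw [norm_smul, norm_neg, Real.norm_of_nonneg (by positivity)] at this
    rw [this]
    exact gradX_sub_le hf _ _
  have e3 := norm_le_add ((mk x y : Z m n) - mk x' y')
  change _ ≤ ‖x - x'‖ + ‖y - y'‖ at e3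
  have := mul_le_mul_of_nonneg_left e3 hℓ.le
  exact le_of_mul_le_mul_left (by linarith) hℓ

end Smooth

/-! ### A priori bounds and existence of the saddle point -/

section Setting

variable {m n : ℕ} {f : Z m n → ℝ} {𝒴 : Set (EuclideanSpace ℝ (Fin n))} {ℓ L D : ℝ}

/-- Differentiating in the direction `d` of the gradient itself gives `‖d‖² ≤ |L| ‖d‖`. The absolute
value is there because `L` may be any real number. -/
theorem norm_gradX_le (h : NonconvexConcave f 𝒴 ℓ L D) (x : EuclideanSpace ℝ (Fin m))
    {y : EuclideanSpace ℝ (Fin n)} (hy : y ∈ 𝒴) : ‖gradX f (mk x y)‖ ≤ |L| := by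
  set d := gradX f (mk x y)
  have h1 := (hasDerivAt_line h.smooth.1 (mk x y) (mk d 0) 0).hasFDerivAt
  have h2 : ∀ s : ℝ, mk x y + s • (mk d 0 : Z m n) = mk (x + s • d) y := by
    intro s
    rw [mk_add_fst]
    congr 1
    change WithLp.toLp 2 (s • (d, (0 : EuclideanSpace ℝ (Fin n)))) = _
    simp [mk]
  simp only [h2] at h1
  have h3 := h1.le_of_lip' (C := |L| * ‖d‖) (by positivity) (Eventually.of_forall fun s => by
    refine (h.lipschitz y hy _ _).trans ?_
    rw [add_sub_add_left_eq_sub, ← sub_smul, norm_smul]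
    have := mul_le_mul_of_nonneg_right (le_abs_self L)
      (mul_nonneg (norm_nonneg (s - 0)) (norm_nonneg d))
    linarith)
  simp [-inner_gradient_left] at h3
  have h4 : ⟪d, d⟫ ≤ |L| * ‖d‖ := (le_abs_self _).trans h3
  rw [real_inner_self_eq_norm_sq] at h4
  by_contra! hlt
  nlinarith [norm_nonneg d, abs_nonneg L]

theorem isCompact_feasible (h : NonconvexConcave f 𝒴 ℓ L D) : IsCompact 𝒴 :=
  Metric.isCompact_of_isClosed_isBounded h.closed h.bounded

theorem norm_sub_le_of_mem (h : NonconvexConcave f 𝒴 ℓ L D) {y y' : EuclideanSpace ℝ (Fin n)}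
    (hy : y ∈ 𝒴) (hy' : y' ∈ 𝒴) : ‖y - y'‖ ≤ |D| := by
  rw [← dist_eq_norm]
  exact (Metric.dist_le_diam_of_mem h.bounded hy hy').trans (h.diam_le.trans (le_abs_self D))

theorem norm_minimizer_sub_center_le (h : NonconvexConcave f 𝒴 ℓ L D) (hℓ : 0 < ℓ)
    {xhat x : EuclideanSpace ℝ (Fin m)} {y : EuclideanSpace ℝ (Fin n)} (hy : y ∈ 𝒴)
    (hx : regGradX f ℓ xhat x y = 0) : ‖x - xhat‖ ≤ |L| / (2 * ℓ) := by
  have h1 := congrArg norm (eq_neg_of_add_eq_zero_right hx)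
  rw [norm_smul, norm_neg, Real.norm_of_nonneg (by positivity)] at h1
  rw [le_div_iff₀' (by positivity), h1]
  exact norm_gradX_le h x hy

/-- `(x, y)` is a saddle point of the regularized objective on `ℝᵐ × 𝒴`. -/
structure IsSaddle (f : Z m n → ℝ) (𝒴 : Set (EuclideanSpace ℝ (Fin n))) (ℓ : ℝ)
    (xhat x : EuclideanSpace ℝ (Fin m)) (y : EuclideanSpace ℝ (Fin n)) : Prop where
  mem : y ∈ 𝒴
  grad : regGradX f ℓ xhat x y = 0
  le : ∀ y' ∈ 𝒴, f (mk x y') ≤ f (mk x y)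

/-- With `b y` the minimizer in `x` for given `y`, the dual function `y ↦ reg (b y) y` is
continuous, since `b` is 1-Lipschitz, and attains its maximum on the compact set `𝒴`. A maximizer
`y` and `b y` form the saddle point. -/
theorem exists_isSaddle (h : NonconvexConcave f 𝒴 ℓ L D) (hℓ : 0 < ℓ)
    (xhat : EuclideanSpace ℝ (Fin m)) : ∃ x y, IsSaddle f 𝒴 ℓ xhat x y := by
  choose b hb using exists_regGradX_eq_zero hℓ h.smooth xhat
  have hbc : Continuous b := by
    refine (LipschitzWith.of_dist_le_mul (K := 1) fun y y' => ?_).continuous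
    simpa [dist_eq_norm] using norm_minimizer_sub_le hℓ h.smooth (hb y) (hb y')
  have hmk : Continuous fun y => (mk (b y) y : Z m n) :=
    (WithLp.prod_continuous_toLp 2 _ _).comp (hbc.prodMk continuous_id)
  have hψ : Continuous fun y => reg f ℓ xhat (b y) y :=
    ((continuous_of_differentiable h.smooth.1).comp hmk).add
      (continuous_const.mul ((hbc.sub continuous_const).norm.pow 2))
  obtain ⟨y, hy, hmax⟩ := (isCompact_feasible h).exists_isMaxOn h.nonempty hψ.continuousOn
  refine ⟨b y, y, hy, hb y, fun y' hy' => ?_⟩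
  -- Concavity bounds `reg (b yt) yt` below by the mix of the values at `y` and `y'`, where the
  -- former is at least `reg (b y) y` by minimality of `b y`. Maximality of `y` then leaves only the
  -- term at `y'`, and `t → 0` replaces `b yt` by `b y`.
  have hseg : ∀ t ∈ Set.Ioo (0 : ℝ) 1,
      reg f ℓ xhat (b (y + t • (y' - y))) y' ≤ reg f ℓ xhat (b y) y := by
    intro t ht
    set yt := y + t • (y' - y)
    have hyt : yt ∈ 𝒴 := h.convex.add_smul_sub_mem hy hy' ⟨ht.1.le, ht.2.le⟩
    have h1 : reg f ℓ xhat (b yt) yt ≤ reg f ℓ xhat (b y) y := hmax hyt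
    have h2 := reg_lower h.smooth xhat (b y) (b yt) y
    rw [hb, inner_zero_left] at h2
    have h3 := (h.concave (b yt)).2 (Set.mem_univ y) (Set.mem_univ y')
      (sub_nonneg.2 ht.2.le) ht.1.le (by ring)
    have e : (1 - t) • y + t • y' = yt := by
      simp only [yt, sub_smul, smul_sub, one_smul]; abel
    simp only [e, smul_eq_mul] at h3
    have h4 : (1 - t) * reg f ℓ xhat (b yt) y + t * reg f ℓ xhat (b yt) y' ≤
        reg f ℓ xhat (b yt) yt := by
      simp only [reg]; nlinarith
    have h5 : 0 ≤ ℓ / 2 * ‖b yt - b y‖ ^ 2 := by positivity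
    have h6 := mul_le_mul_of_nonneg_left (by linarith : reg f ℓ xhat (b y) y ≤
      reg f ℓ xhat (b yt) y) (sub_nonneg.2 ht.2.le)
    have h7 : t * reg f ℓ xhat (b yt) y' ≤ t * reg f ℓ xhat (b y) y := by linarith
    exact le_of_mul_le_mul_left h7 ht.1
  have hcont : Continuous fun t : ℝ => reg f ℓ xhat (b (y + t • (y' - y))) y' := by
    have h1 : Continuous fun t : ℝ => b (y + t • (y' - y)) := by fun_prop
    have h2 : Continuous fun t : ℝ => (mk (b (y + t • (y' - y))) y' : Z m n) :=
      (WithLp.prod_continuous_toLp 2 _ _).comp (h1.prodMk continuous_const)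
    exact ((continuous_of_differentiable h.smooth.1).comp h2).add
      (continuous_const.mul ((h1.sub continuous_const).norm.pow 2))
  have hlim : Tendsto (fun t : ℝ => reg f ℓ xhat (b (y + t • (y' - y))) y') (𝓝[>] 0)
      (𝓝 (reg f ℓ xhat (b y) y')) := by
    have := hcont.tendsto 0
    simp only [zero_smul, add_zero] at this
    exact this.mono_left nhdsWithin_le_nhds
  have := le_of_tendsto hlim (by
    filter_upwards [Ioo_mem_nhdsGT (zero_lt_one' ℝ)] with t ht using hseg t ht)
  simp only [reg] at this
  linarith

end Setting

/-! ### The Moreau envelope -/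

section Moreau

variable {m n : ℕ} {f : Z m n → ℝ} {𝒴 : Set (EuclideanSpace ℝ (Fin n))} {ℓ L D : ℝ}

theorem le_primal (h : NonconvexConcave f 𝒴 ℓ L D) (x : EuclideanSpace ℝ (Fin m))
    {y : EuclideanSpace ℝ (Fin n)} (hy : y ∈ 𝒴) : f (mk x y) ≤ primal f 𝒴 x := by
  refine le_csSup ?_ (Set.mem_image_of_mem _ hy)
  refine (isCompact_feasible h).bddAbove_image (Continuous.continuousOn ?_)
  exact (continuous_of_differentiable h.smooth.1).comp
    ((WithLp.prod_continuous_toLp 2 _ _).comp (continuous_const.prodMk continuous_id))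

theorem IsSaddle.primal_eq (h : NonconvexConcave f 𝒴 ℓ L D)
    {xhat x : EuclideanSpace ℝ (Fin m)} {y : EuclideanSpace ℝ (Fin n)}
    (hs : IsSaddle f 𝒴 ℓ xhat x y) : primal f 𝒴 x = f (Minimax.mk x y) := by
  refine le_antisymm (csSup_le (h.nonempty.image _) ?_) (le_primal h x hs.mem)
  rintro _ ⟨y', hy', rfl⟩
  exact hs.le y' hy'

/-- `Φ` dominates `f (·, y)` and touches it at `x`, so the strong convexity of the latter
(regularized) at its minimizer passes to `Φ`. -/
theorem IsSaddle.growth (h : NonconvexConcave f 𝒴 ℓ L D)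
    {xhat x : EuclideanSpace ℝ (Fin m)} {y : EuclideanSpace ℝ (Fin n)}
    (hs : IsSaddle f 𝒴 ℓ xhat x y) (w : EuclideanSpace ℝ (Fin m)) :
    primal f 𝒴 x + ℓ * ‖x - xhat‖ ^ 2 + ℓ / 2 * ‖w - x‖ ^ 2 ≤
      primal f 𝒴 w + ℓ * ‖w - xhat‖ ^ 2 := by
  have h1 := reg_lower h.smooth xhat x w y
  rw [hs.grad, inner_zero_left, reg, reg] at h1
  rw [hs.primal_eq h]
  linarith [le_primal h w hs.mem]

/-- The envelope at `xhat + d` lies within `ℓ ‖d‖²` of an affine function of `d`: from above by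
testing the infimum at `w = x`, from below by the quadratic growth around `x`. -/
theorem IsSaddle.hasGradientAt_moreau (h : NonconvexConcave f 𝒴 ℓ L D) (hℓ : 0 < ℓ)
    {xhat x : EuclideanSpace ℝ (Fin m)} {y : EuclideanSpace ℝ (Fin n)}
    (hs : IsSaddle f 𝒴 ℓ xhat x y) :
    HasGradientAt (moreau (primal f 𝒴) (1 / (2 * ℓ))) ((2 * ℓ) • (xhat - x)) xhat := by
  have hc : 1 / (2 * (1 / (2 * ℓ))) = ℓ := by field_simp
  set V := primal f 𝒴 x + ℓ * ‖x - xhat‖ ^ 2 with hV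
  have hlow : ∀ d w, V + ⟪(2 * ℓ) • (xhat - x), d⟫ - ℓ * ‖d‖ ^ 2 ≤
      primal f 𝒴 w + ℓ * ‖w - (xhat + d)‖ ^ 2 := by
    intro d w
    have h1 := hs.growth h w
    have e1 : ‖w - (xhat + d)‖ ^ 2 =
        ‖w - xhat‖ ^ 2 - 2 * (⟪w - x, d⟫ - ⟪xhat - x, d⟫) + ‖d‖ ^ 2 := by
      rw [← inner_sub_left, sub_sub_sub_cancel_right, ← sub_sub, norm_sub_sq_real]
    -- Completing the square: the growth term `ℓ / 2 ‖w - x‖²` absorbs the cross term `2 ℓ ⟪w - x,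
    -- d⟫` at the price of `2 ℓ ‖d‖²`.
    have h2 : 0 ≤ ‖(w - x) - (2 : ℝ) • d‖ ^ 2 := by positivity
    rw [norm_sub_sq_real, real_inner_smul_right, norm_smul, mul_pow] at h2
    norm_num at h2
    have h3 := mul_nonneg hℓ.le h2
    rw [e1, real_inner_smul_left]
    nlinarith
  have hbdd : ∀ d, BddBelow (Set.range fun w =>
      primal f 𝒴 w + ℓ * ‖w - (xhat + d)‖ ^ 2) := by
    rintro d
    refine ⟨V + ⟪(2 * ℓ) • (xhat - x), d⟫ - ℓ * ‖d‖ ^ 2, ?_⟩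
    rintro _ ⟨w, rfl⟩
    exact hlow d w
  have h1 : ∀ d, V + ⟪(2 * ℓ) • (xhat - x), d⟫ - ℓ * ‖d‖ ^ 2 ≤
      moreau (primal f 𝒴) (1 / (2 * ℓ)) (xhat + d) := by
    intro d
    rw [moreau, hc]
    exact le_ciInf (hlow d)
  have h2 : ∀ d, moreau (primal f 𝒴) (1 / (2 * ℓ)) (xhat + d) ≤
      V + ⟪(2 * ℓ) • (xhat - x), d⟫ + ℓ * ‖d‖ ^ 2 := by
    intro d
    rw [moreau, hc]
    refine (ciInf_le (hbdd d) x).trans (le_of_eq ?_)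
    rw [← sub_sub, norm_sub_sq_real, real_inner_smul_left, hV, ← neg_sub xhat x,
      inner_neg_left, norm_neg]
    ring
  have h0 : moreau (primal f 𝒴) (1 / (2 * ℓ)) xhat = V := by
    have a1 := h1 0
    have a2 := h2 0
    simp only [inner_zero_right, norm_zero, add_zero, ne_eq, OfNat.ofNat_ne_zero,
      not_false_eq_true, zero_pow, mul_zero, sub_zero] at a1 a2
    exact le_antisymm a2 a1
  rw [hasGradientAt_iff_isLittleO_nhds_zero]
  refine Asymptotics.IsBigO.trans_isLittleO (Asymptotics.IsBigO.of_bound ℓ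
    (Eventually.of_forall fun d => ?_)) (Asymptotics.isLittleO_norm_pow_id one_lt_two)
  rw [h0, Real.norm_eq_abs, norm_pow, norm_norm, abs_le]
  constructor <;> linarith [h1 d, h2 d]

theorem IsSaddle.isMoreauStationary_iff (h : NonconvexConcave f 𝒴 ℓ L D) (hℓ : 0 < ℓ)
    {xhat x : EuclideanSpace ℝ (Fin m)} {y : EuclideanSpace ℝ (Fin n)}
    (hs : IsSaddle f 𝒴 ℓ xhat x y) {ε : ℝ} :
    IsMoreauStationary ℓ (primal f 𝒴) ε xhat ↔ 2 * ℓ * ‖x - xhat‖ ≤ ε := by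
  have hg := hs.hasGradientAt_moreau h hℓ
  rw [IsMoreauStationary, hg.gradient, norm_smul, Real.norm_of_nonneg (by positivity),
    norm_sub_rev]
  exact and_iff_right hg.differentiableAt

/-- The variational inequality of the projected step, scaled by `ℓ`. The base point `y` need not lie
in `𝒴`, which the converse direction needs. -/
theorem inner_gradient_proj_step_le (h : NonconvexConcave f 𝒴 ℓ L D) (hℓ : 0 < ℓ)
    (y v : EuclideanSpace ℝ (Fin n)) {q : EuclideanSpace ℝ (Fin n)} (hq : q ∈ 𝒴) :
    ⟪v, q - proj 𝒴 (y + (1 / ℓ) • v)⟫ ≤ ℓ * ⟪gradMap 𝒴 ℓ y v, q - proj 𝒴 (y + (1 / ℓ) • v)⟫ := by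
  have h1 := (proj_spec h.nonempty h.closed h.convex (y + (1 / ℓ) • v)).2 q hq
  rw [gradMap]
  set p := proj 𝒴 (y + (1 / ℓ) • v)
  have e : y + (1 / ℓ) • v - p = (1 / ℓ) • v - (p - y) := by abel
  rw [e, inner_sub_left, real_inner_smul_left] at h1
  have h2 := mul_le_mul_of_nonneg_left h1 hℓ.le
  rw [mul_sub, ← mul_assoc, mul_one_div_cancel hℓ.ne', one_mul, mul_zero] at h2
  linarith

theorem isMoreauStationary_of_isStationaryPair (h : NonconvexConcave f 𝒴 ℓ L D) (hℓ : 0 < ℓ)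
    {ε : ℝ} (hε : 0 ≤ ε) {xhat : EuclideanSpace ℝ (Fin m)} {yhat : EuclideanSpace ℝ (Fin n)}
    (hst : IsStationaryPair f 𝒴 ℓ (ε ^ 2) (mk xhat yhat)) :
    IsMoreauStationary ℓ (primal f 𝒴) ((4 * |L| + 8 * ℓ * |D| + 1) * ε) xhat := by
  obtain ⟨x, y, hs⟩ := exists_isSaddle h hℓ xhat
  rw [hs.isMoreauStationary_iff h hℓ]
  obtain ⟨hx, hy⟩ := hst
  change ‖gradMap 𝒴 ℓ yhat _‖ ≤ _ at hy
  set v := gradY f (mk xhat yhat)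
  set p := proj 𝒴 (yhat + (1 / ℓ) • v)
  -- `yhat` may lie outside `𝒴`, so its projected ascent step `p` takes its place; moving from
  -- `yhat` to `p` changes each partial gradient by at most `ε²`.
  have hp : p ∈ 𝒴 := (proj_spec h.nonempty h.closed h.convex _).1
  have hpy : ‖p - yhat‖ ≤ ε ^ 2 / ℓ := hy
  have e1 : ‖(mk xhat p : Z m n) - mk xhat yhat‖ ≤ ε ^ 2 / ℓ := by
    have : (mk xhat p : Z m n) - mk xhat yhat = mk 0 (p - yhat) := by
      rw [sub_eq_iff_eq_add', ← mk_add_snd, add_sub_cancel]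
    rwa [this, norm_mk_snd]
  have e2 : ℓ * ‖(mk xhat p : Z m n) - mk xhat yhat‖ ≤ ε ^ 2 := by
    rwa [le_div_iff₀' hℓ] at e1
  have hgx : ‖gradX f (mk xhat p)‖ ≤ 2 * ε ^ 2 := by
    have a1 := (gradX_sub_le h.smooth (mk xhat p) (mk xhat yhat)).trans e2
    have a2 := norm_le_norm_add_norm_sub' (gradX f (mk xhat p)) (gradX f (mk xhat yhat))
    linarith
  have hD : ‖y - p‖ ≤ |D| := norm_sub_le_of_mem h hs.mem hp
  have hgy : ⟪gradY f (mk xhat p), y - p⟫ ≤ 2 * ε ^ 2 * |D| := by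
    have a1 := (gradY_sub_le h.smooth (mk xhat p) (mk xhat yhat)).trans e2
    have a2 : ⟪v, y - p⟫ ≤ ℓ * ⟪gradMap 𝒴 ℓ yhat v, y - p⟫ :=
      inner_gradient_proj_step_le h hℓ yhat v hs.mem
    have a3 : ⟪gradMap 𝒴 ℓ yhat v, y - p⟫ ≤ ε ^ 2 / ℓ * |D| :=
      (real_inner_le_norm _ _).trans (mul_le_mul hy hD (norm_nonneg _) (by positivity))
    have a4 : ⟪gradY f (mk xhat p) - v, y - p⟫ ≤ ε ^ 2 * |D| :=
      (real_inner_le_norm _ _).trans (mul_le_mul a1 hD (norm_nonneg _) (by positivity))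
    have a5 : ℓ * (ε ^ 2 / ℓ * |D|) = ε ^ 2 * |D| := by field_simp
    rw [inner_sub_left] at a4
    have a6 := mul_le_mul_of_nonneg_left a3 hℓ.le
    linarith
  -- Strong convexity is used from `x` to `xhat` at `y` and back at `p`; each use contributes `ℓ / 2
  -- ‖x - xhat‖²`, and the values cancel up to first-order terms of size `ε²`.
  have b1 := reg_lower h.smooth xhat x xhat y
  rw [hs.grad, inner_zero_left] at b1
  have b2 := hs.le p hp
  have b3 := reg_lower h.smooth xhat xhat x p
  have b4 := reg_concave_upper (ℓ := ℓ) h.smooth.1 (h.concave xhat) xhat p y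
  have b5 : -(2 * ε ^ 2 * ‖x - xhat‖) ≤ ⟪regGradX f ℓ xhat xhat p, x - xhat⟫ := by
    rw [regGradX, sub_self, smul_zero, add_zero]
    have := (abs_le.1 (abs_real_inner_le_norm (gradX f (mk xhat p)) (x - xhat))).1
    have := mul_le_mul_of_nonneg_right hgx (norm_nonneg (x - xhat))
    linarith
  rw [norm_sub_rev xhat x] at b1
  have b6 : ℓ * ‖x - xhat‖ ^ 2 ≤ 2 * ε ^ 2 * ‖x - xhat‖ + 2 * ε ^ 2 * |D| := by
    have : reg f ℓ xhat x p ≤ reg f ℓ xhat x y := by rw [reg, reg]; linarith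
    linarith
  have b7 := norm_minimizer_sub_center_le h hℓ hs.mem hs.grad
  rw [le_div_iff₀' (by positivity)] at b7
  refine (sq_le_sq₀ (by positivity) (by positivity)).1 ?_
  have b8 : (2 * ℓ * ‖x - xhat‖) ^ 2 ≤ (4 * |L| + 8 * ℓ * |D|) * ε ^ 2 := by
    have c1 := mul_le_mul_of_nonneg_left b6 (by positivity : 0 ≤ 4 * ℓ)
    have c2 := mul_le_mul_of_nonneg_left b7 (by positivity : 0 ≤ 4 * ε ^ 2)
    linarith
  refine b8.trans ?_
  rw [mul_pow]
  gcongr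
  -- With `a = 4 |L| + 8 ℓ |D|`, the summand `1` in the constant serves for `a ≤ (a + 1)²`.
  have : 0 ≤ 4 * |L| + 8 * ℓ * |D| := by positivity
  nlinarith

end Moreau

/-! ### One iteration of the extragradient method -/

section Step

/-- The sum of the two variational inequalities leaves a cross term between `z' - w` and `η (g' -
g)`; the square `‖z' - w + η (g' - g)‖² ≥ 0` absorbs it. -/
theorem extragradient_inequality {E : Type*} [NormedAddCommGroup E] [InnerProductSpace ℝ E]
    {η : ℝ} {z w z' g g' u : E} (hw : ⟪z - η • g - w, z' - w⟫ ≤ 0)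
    (hz : ⟪z - η • g' - z', u - z'⟫ ≤ 0) :
    ‖z' - u‖ ^ 2 ≤ ‖z - u‖ ^ 2 - 2 * η * ⟪g', w - u⟫ - ‖w - z‖ ^ 2 + η ^ 2 * ‖g' - g‖ ^ 2 := by
  obtain ⟨a, ha⟩ : ∃ a, a = z - w := ⟨_, rfl⟩
  obtain ⟨b, hb⟩ : ∃ b, b = z' - w := ⟨_, rfl⟩
  obtain ⟨c, hc⟩ : ∃ c, c = u - w := ⟨_, rfl⟩
  have e1 : z - η • g - w = a - η • g := by rw [ha]; abel
  have e2 : z - η • g' - z' = a - b - η • g' := by rw [ha, hb]; abel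
  have e3 : u - z' = c - b := by rw [hb, hc]; abel
  have e4 : z' - u = b - c := by rw [hb, hc]; abel
  have e5 : z - u = a - c := by rw [ha, hc]; abel
  have e6 : w - u = -c := by rw [hc]; abel
  have e7 : w - z = -a := by rw [ha]; abel
  rw [e1, ← hb] at hw
  rw [e2, e3] at hz
  rw [e4, e5, e6, e7, norm_neg, inner_neg_right, norm_sub_sq_real, norm_sub_sq_real]
  have h0 : 0 ≤ ‖b + η • (g' - g)‖ ^ 2 := by positivity
  rw [norm_add_sq_real, norm_smul, mul_pow, Real.norm_eq_abs, sq_abs] at h0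
  simp only [inner_sub_left, inner_sub_right, real_inner_smul_left, real_inner_smul_right,
    real_inner_self_eq_norm_sq, real_inner_comm b] at hw hz h0 ⊢
  linarith

variable {m n : ℕ} {f : Z m n → ℝ} {𝒴 : Set (EuclideanSpace ℝ (Fin n))} {ℓ L D : ℝ}

/-- The descent-ascent direction of the regularized problem at `w`, when `g` stands for the
gradient of `f` at `w`. -/
def saddleOp (ℓ : ℝ) (xhat : EuclideanSpace ℝ (Fin m)) (w g : Z m n) : Z m n :=
  mk (g.fst + (2 * ℓ) • (w.fst - xhat)) (-g.snd)

theorem step_snd_mem (h : NonconvexConcave f 𝒴 ℓ L D) (xhat : EuclideanSpace ℝ (Fin m))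
    (η : ℝ) (z w g : Z m n) : (step 𝒴 ℓ xhat η z w g).snd ∈ 𝒴 :=
  (proj_spec h.nonempty h.closed h.convex _).1

theorem inner_step_le (h : NonconvexConcave f 𝒴 ℓ L D) (xhat : EuclideanSpace ℝ (Fin m))
    (η : ℝ) (z w g : Z m n) {u : Z m n} (hu : u.snd ∈ 𝒴) :
    ⟪z - η • saddleOp ℓ xhat w g - step 𝒴 ℓ xhat η z w g, u - step 𝒴 ℓ xhat η z w g⟫ ≤ 0 := by
  have h1 := (proj_spec h.nonempty h.closed h.convex (z.snd + η • g.snd)).2 u.snd hu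
  rw [inner_Z]
  have e1 : (z - η • saddleOp ℓ xhat w g - step 𝒴 ℓ xhat η z w g).fst = 0 := by
    simp [saddleOp, step, mk]
  have e2 : (z - η • saddleOp ℓ xhat w g - step 𝒴 ℓ xhat η z w g).snd =
      z.snd + η • g.snd - proj 𝒴 (z.snd + η • g.snd) := by
    simp [saddleOp, step, mk]
  rw [e1, e2, inner_zero_left, zero_add]
  exact h1

/-- The sign change is an isometry and the regularizer adds `2 ℓ`. With exact gradients the operator
is therefore `3 ℓ`-Lipschitz, which dictates stepsizes of at most `1 / (6 ℓ)`. -/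
theorem norm_saddleOp_sub_le (hℓ : 0 < ℓ) (xhat : EuclideanSpace ℝ (Fin m)) (w z g g' : Z m n) :
    ‖saddleOp ℓ xhat w g - saddleOp ℓ xhat z g'‖ ≤ ‖g - g'‖ + 2 * ℓ * ‖w - z‖ := by
  have e : saddleOp ℓ xhat w g - saddleOp ℓ xhat z g' =
      mk (g - g').fst (-(g - g').snd) + mk ((2 * ℓ) • (w - z).fst) 0 := by
    refine WithLp.ofLp_injective 2 (Prod.ext ?_ ?_)
    · change g.fst + (2 * ℓ) • (w.fst - xhat) - (g'.fst + (2 * ℓ) • (z.fst - xhat)) =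
        (g.fst - g'.fst) + (2 * ℓ) • (w.fst - z.fst)
      module
    · change -g.snd - -g'.snd = -(g.snd - g'.snd) + 0
      abel
  have e1 : ‖(mk (g - g').fst (-(g - g').snd) : Z m n)‖ = ‖g - g'‖ := by
    refine (sq_eq_sq₀ (norm_nonneg _) (norm_nonneg _)).1 ?_
    rw [norm_sq_Z, norm_sq_Z]
    change ‖(g - g').fst‖ ^ 2 + ‖-(g - g').snd‖ ^ 2 = _
    rw [norm_neg]
  rw [e]
  refine (norm_add_le _ _).trans ?_
  rw [e1, norm_mk_fst, norm_smul, Real.norm_of_nonneg (by positivity)]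
  gcongr
  exact norm_fst_le _

/-- Strong convexity in `x` and concavity in `y` are both expanded at `w`, so the value at `w`
cancels and the gap towards `u` remains. -/
theorem le_inner_saddleOp (h : NonconvexConcave f 𝒴 ℓ L D) (xhat : EuclideanSpace ℝ (Fin m))
    (w u : Z m n) :
    reg f ℓ xhat w.fst u.snd - reg f ℓ xhat u.fst w.snd + ℓ / 2 * ‖w.fst - u.fst‖ ^ 2 ≤
      ⟪saddleOp ℓ xhat w (∇ f w), w - u⟫ := by
  have h1 := reg_lower h.smooth xhat w.fst u.fst w.snd
  have h2 := reg_concave_upper (ℓ := ℓ) h.smooth.1 (h.concave w.fst) xhat w.snd u.snd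
  have e : ⟪saddleOp ℓ xhat w (∇ f w), w - u⟫ =
      -⟪regGradX f ℓ xhat w.fst w.snd, u.fst - w.fst⟫ +
        ⟪gradY f (mk w.fst w.snd), u.snd - w.snd⟫ := by
    rw [inner_Z]
    change ⟪regGradX f ℓ xhat w.fst w.snd, w.fst - u.fst⟫ +
      ⟪-gradY f (mk w.fst w.snd), w.snd - u.snd⟫ = _
    rw [← neg_sub w.fst, ← neg_sub w.snd, inner_neg_right, inner_neg_right, inner_neg_left]
    ring
  rw [e, norm_sub_rev]
  linarith

end Step

/-! ### The extragradient method -/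

section Extragradient

variable {m n : ℕ} {f : Z m n → ℝ} {𝒴 : Set (EuclideanSpace ℝ (Fin n))} {ℓ L D : ℝ}

/-- Comparison points whose first block minimizes the regularized objective lie within a distance
of the starting point that depends only on `ℓ`, `L` and `D`. -/
theorem sq_norm_start_sub_le (h : NonconvexConcave f 𝒴 ℓ L D) (hℓ : 0 < ℓ)
    {xhat x : EuclideanSpace ℝ (Fin m)} {y y' y₀ : EuclideanSpace ℝ (Fin n)} (hy : y ∈ 𝒴)
    (hx : regGradX f ℓ xhat x y = 0) (hy₀ : y₀ ∈ 𝒴) (hy' : y' ∈ 𝒴) :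
    ‖(mk xhat y₀ : Z m n) - mk x y'‖ ^ 2 ≤ (|L| / (2 * ℓ)) ^ 2 + |D| ^ 2 := by
  rw [norm_sq_Z]
  have h1 := norm_minimizer_sub_center_le h hℓ hy hx
  have h2 := norm_sub_le_of_mem h hy₀ hy'
  rw [norm_sub_rev] at h1
  exact add_le_add (pow_le_pow_left₀ (norm_nonneg _) h1 2) (pow_le_pow_left₀ (norm_nonneg _) h2 2)

/-- The distance to a saddle point decreases in an extragradient iteration. -/
theorem IsSaddle.extragradient_descent (h : NonconvexConcave f 𝒴 ℓ L D) (hℓ : 0 < ℓ)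
    {xhat x : EuclideanSpace ℝ (Fin m)} {y : EuclideanSpace ℝ (Fin n)}
    (hs : IsSaddle f 𝒴 ℓ xhat x y) (z : Z m n) :
    let w := step 𝒴 ℓ xhat (1 / (6 * ℓ)) z z (∇ f z)
    ‖step 𝒴 ℓ xhat (1 / (6 * ℓ)) z w (∇ f w) - Minimax.mk x y‖ ^ 2 ≤
      ‖z - Minimax.mk x y‖ ^ 2 - 1 / 3 * ‖w.fst - x‖ ^ 2 - 3 / 4 * ‖w - z‖ ^ 2 := by
  intro w
  have hw : w.snd ∈ 𝒴 := step_snd_mem h xhat _ _ _ _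
  have h1 := extragradient_inequality
    (inner_step_le h xhat (1 / (6 * ℓ)) z z (∇ f z)
      (step_snd_mem h xhat (1 / (6 * ℓ)) z w (∇ f w)))
    (inner_step_le h xhat (1 / (6 * ℓ)) z w (∇ f w) (u := Minimax.mk x y) hs.mem)
  have h2 := le_inner_saddleOp h xhat w (Minimax.mk x y)
  have h3 := norm_saddleOp_sub_le hℓ xhat w z (∇ f w) (∇ f z)
  have h4 := h.smooth.2 w z
  have h5 := reg_lower h.smooth xhat x w.fst y
  rw [hs.grad, inner_zero_left] at h5
  have h6 := hs.le _ hw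
  change reg f ℓ xhat w.fst y - reg f ℓ xhat x w.snd + ℓ / 2 * ‖w.fst - x‖ ^ 2 ≤ _ at h2
  have h7 : reg f ℓ xhat x w.snd ≤ reg f ℓ xhat x y := by rw [reg, reg]; linarith
  have h8 : ℓ * ‖w.fst - x‖ ^ 2 ≤ ⟪saddleOp ℓ xhat w (∇ f w), w - Minimax.mk x y⟫ := by linarith
  -- `h8` has modulus `ℓ` instead of `ℓ / 2` because strong convexity enters twice, through the
  -- operator inequality and through the growth at the saddle point.
  have h9 := mul_le_mul_of_nonneg_left h8 (by positivity : 0 ≤ 2 * (1 / (6 * ℓ)))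
  have h10 : 2 * (1 / (6 * ℓ)) * (ℓ * ‖w.fst - x‖ ^ 2) = 1 / 3 * ‖w.fst - x‖ ^ 2 := by
    field_simp; ring
  have h11 : ‖saddleOp ℓ xhat w (∇ f w) - saddleOp ℓ xhat z (∇ f z)‖ ^ 2 ≤
      (3 * ℓ * ‖w - z‖) ^ 2 := pow_le_pow_left₀ (norm_nonneg _) (by linarith) 2
  have h12 := mul_le_mul_of_nonneg_left h11 (by positivity : 0 ≤ (1 / (6 * ℓ)) ^ 2)
  have h13 : (1 / (6 * ℓ)) ^ 2 * (3 * ℓ * ‖w - z‖) ^ 2 = 1 / 4 * ‖w - z‖ ^ 2 := by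
    field_simp; ring
  linarith

/-- An extrapolated point that is close to the saddle point in `x` and close to the previous
iterate is nearly stationary. -/
theorem isStationaryPair_of_close (h : NonconvexConcave f 𝒴 ℓ L D) (hℓ : 0 < ℓ)
    {xhat x : EuclideanSpace ℝ (Fin m)} {z : Z m n} {ε r : ℝ} (hx : 2 * ℓ * ‖x - xhat‖ ≤ ε)
    (hw : ‖(step 𝒴 ℓ xhat (1 / (6 * ℓ)) z z (∇ f z)).fst - x‖ ≤ r)
    (hwz : ‖step 𝒴 ℓ xhat (1 / (6 * ℓ)) z z (∇ f z) - z‖ ≤ r) :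
    IsStationaryPair f 𝒴 ℓ (11 * ℓ * r + ε) (step 𝒴 ℓ xhat (1 / (6 * ℓ)) z z (∇ f z)) := by
  set w := step 𝒴 ℓ xhat (1 / (6 * ℓ)) z z (∇ f z) with hwdef
  have hε : 0 ≤ ε := le_trans (by positivity) hx
  have hr : 0 ≤ r := (norm_nonneg _).trans hwz
  have hlip : ℓ * ‖w - z‖ ≤ ℓ * r := by gcongr
  constructor
  · have e1 : gradX f z + (2 * ℓ) • (z.fst - xhat) = -((6 * ℓ) • (w.fst - z.fst)) := by
      have : w.fst = z.fst - (1 / (6 * ℓ)) • (gradX f z + (2 * ℓ) • (z.fst - xhat)) := rfl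
      rw [this, sub_sub_cancel_left, smul_neg, neg_neg, smul_smul,
        mul_one_div_cancel (by positivity), one_smul]
    -- The step equation `e1` trades the gradient at `z` for the step length; all four remaining
    -- pieces are small by hypothesis and sum to at most `7 ℓ r + ε`.
    have e2 : gradX f w = (gradX f w - gradX f z) - (4 * ℓ) • (w.fst - z.fst)
        - (2 * ℓ) • (w.fst - x) - (2 * ℓ) • (x - xhat) := by
      have : gradX f z = -((6 * ℓ) • (w.fst - z.fst)) - (2 * ℓ) • (z.fst - xhat) := by
        rw [← e1]; abel
      rw [this]
      module
    have n1 := (gradX_sub_le h.smooth w z).trans hlip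
    have n2 : ‖(4 * ℓ) • (w.fst - z.fst)‖ ≤ 4 * ℓ * r := by
      rw [norm_smul, Real.norm_of_nonneg (by positivity)]
      gcongr
      exact (norm_fst_le (w - z)).trans hwz
    have n3 : ‖(2 * ℓ) • (w.fst - x)‖ ≤ 2 * ℓ * r := by
      rw [norm_smul, Real.norm_of_nonneg (by positivity)]
      gcongr
    have n4 : ‖(2 * ℓ) • (x - xhat)‖ ≤ ε := by
      rwa [norm_smul, Real.norm_of_nonneg (by positivity)]
    rw [e2]
    refine (norm_sub_le _ _).trans ?_
    have m1 := norm_sub_le ((gradX f w - gradX f z) - (4 * ℓ) • (w.fst - z.fst))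
      ((2 * ℓ) • (w.fst - x))
    have m2 := norm_sub_le (gradX f w - gradX f z) ((4 * ℓ) • (w.fst - z.fst))
    have : 0 ≤ ℓ * r := by positivity
    linarith
  · have hws : w.snd = proj 𝒴 (z.snd + (1 / (6 * ℓ)) • gradY f z) := rfl
    -- The stationarity measure uses stepsize `1 / ℓ` and the algorithm `1 / (6 ℓ)`, which costs a
    -- factor 6. The three parts of the displacement then add up to `2 r + 6 r + r = 9 r`, within
    -- the allowance `11 r`.
    have g1 := norm_proj_step_le h.nonempty h.closed h.convex z.snd (gradY f z)
      (η := 1 / (6 * ℓ)) (s := 1 / ℓ) (by positivity)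
      (one_div_le_one_div_of_le hℓ (by linarith))
    rw [← hws] at g1
    have g2 : ‖w.snd - z.snd‖ ≤ r := (norm_snd_le (w - z)).trans hwz
    have g3 : 1 / ℓ / (1 / (6 * ℓ)) = 6 := by field_simp
    rw [g3] at g1
    have g4 := norm_proj_sub_le h.nonempty h.closed h.convex (w.snd + (1 / ℓ) • gradY f w)
      (z.snd + (1 / ℓ) • gradY f z)
    have g5 : ‖w.snd + (1 / ℓ) • gradY f w - (z.snd + (1 / ℓ) • gradY f z)‖ ≤ r + r := by
      have : w.snd + (1 / ℓ) • gradY f w - (z.snd + (1 / ℓ) • gradY f z) =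
          (w.snd - z.snd) + (1 / ℓ) • (gradY f w - gradY f z) := by module
      rw [this]
      refine (norm_add_le _ _).trans (add_le_add g2 ?_)
      rw [norm_smul, Real.norm_of_nonneg (by positivity), one_div_mul_eq_div, div_le_iff₀' hℓ]
      exact (gradY_sub_le h.smooth w z).trans hlip
    have g6 : gradMap 𝒴 ℓ w.snd (gradY f w) =
        (proj 𝒴 (w.snd + (1 / ℓ) • gradY f w) - proj 𝒴 (z.snd + (1 / ℓ) • gradY f z)) +
        (proj 𝒴 (z.snd + (1 / ℓ) • gradY f z) - z.snd) - (w.snd - z.snd) := by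
      rw [gradMap]; abel
    have g7 := norm_sub_le
      ((proj 𝒴 (w.snd + (1 / ℓ) • gradY f w) - proj 𝒴 (z.snd + (1 / ℓ) • gradY f z)) +
        (proj 𝒴 (z.snd + (1 / ℓ) • gradY f z) - z.snd)) (w.snd - z.snd)
    have g8 := norm_add_le
      (proj 𝒴 (w.snd + (1 / ℓ) • gradY f w) - proj 𝒴 (z.snd + (1 / ℓ) • gradY f z))
        (proj 𝒴 (z.snd + (1 / ℓ) • gradY f z) - z.snd)
    rw [← g6] at g7
    rw [le_div_iff₀ hℓ]
    have g9 : ‖gradMap 𝒴 ℓ w.snd (gradY f w)‖ ≤ 9 * r := by linarith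
    have := mul_le_mul_of_nonneg_right g9 hℓ.le
    have : 0 ≤ ℓ * r := by positivity
    linarith

/-- A potential argument: `‖z - mk x y‖² < T r²` is a budget from which every iteration that fails
the test takes more than `r²`. It is contradictory at `T = 0`, so the test succeeds before the
iterations run out. -/
theorem extragradient_run (h : NonconvexConcave f 𝒴 ℓ L D) (hℓ : 0 < ℓ)
    {xhat x : EuclideanSpace ℝ (Fin m)} {y : EuclideanSpace ℝ (Fin n)}
    (hs : IsSaddle f 𝒴 ℓ xhat x y) {ε r δ : ℝ} (hr : 0 ≤ r) (hx : 2 * ℓ * ‖x - xhat‖ ≤ ε)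
    (hδ : 11 * ℓ * (2 * r) + ε ≤ δ) (T : ℕ) (z : Z m n) (k : ℕ)
    (hz : ‖z - mk x y‖ ^ 2 < T * r ^ 2) :
    let R := (extragradient 𝒴 ℓ xhat (1 / (6 * ℓ)) δ T z).runFrom (fun _ z => ∇ f z) k
    R.2 ≤ k + 2 * T ∧ R.1.snd ∈ 𝒴 ∧ IsStationaryPair f 𝒴 ℓ δ R.1 := by
  induction T generalizing z k with
  | zero =>
    rw [Nat.cast_zero, zero_mul] at hz
    exact absurd hz (not_lt.2 (by positivity))
  | succ T ih =>
    have hd := hs.extragradient_descent h hℓ z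
    simp only [extragradient, FirstOrder.runFrom]
    set w := step 𝒴 ℓ xhat (1 / (6 * ℓ)) z z (∇ f z) with hw
    split_ifs with hst
    · simp only [FirstOrder.runFrom]
      exact ⟨by lia, step_snd_mem h xhat _ _ _ _, hst⟩
    · have hlarge : r ^ 2 < 1 / 3 * ‖w.fst - x‖ ^ 2 + 3 / 4 * ‖w - z‖ ^ 2 := by
        by_contra! hle
        refine hst ?_
        have h1 : ‖w.fst - x‖ ≤ 2 * r :=
          (sq_le_sq₀ (norm_nonneg _) (by positivity)).1 (by nlinarith [sq_nonneg ‖w - z‖])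
        have h2 : ‖w - z‖ ≤ 2 * r :=
          (sq_le_sq₀ (norm_nonneg _) (by positivity)).1 (by nlinarith [sq_nonneg ‖w.fst - x‖])
        obtain ⟨a1, a2⟩ := isStationaryPair_of_close h hℓ hx h1 h2
        exact ⟨a1.trans hδ, a2.trans (div_le_div_of_nonneg_right hδ hℓ.le)⟩
      have := ih (step 𝒴 ℓ xhat (1 / (6 * ℓ)) z w (∇ f w)) (k + 1 + 1)
        (by push_cast at hz; simp only at hd; linarith)
      refine ⟨?_, this.2⟩
      have := this.1
      lia

/-- Needed for `ε ≥ 1`, where the allowed number of calls may be below one and the starting point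
has to be good enough. -/
theorem isStationaryPair_start (h : NonconvexConcave f 𝒴 ℓ L D) (hℓ : 0 < ℓ) {δ : ℝ}
    (hL : |L| ≤ δ) (hD : ℓ * |D| ≤ δ) (x : EuclideanSpace ℝ (Fin m))
    {y : EuclideanSpace ℝ (Fin n)} (hy : y ∈ 𝒴) : IsStationaryPair f 𝒴 ℓ δ (mk x y) := by
  refine ⟨(norm_gradX_le h x hy).trans hL, ?_⟩
  rw [le_div_iff₀' hℓ]
  refine le_trans ?_ hD
  gcongr
  exact norm_sub_le_of_mem h (proj_spec h.nonempty h.closed h.convex _).1 hy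

theorem extragradient_complexity (ℓ L D : ℝ) (hℓ : 0 < ℓ) :
    ∃ C : ℝ, 0 < C ∧ ∀ ε : ℝ, 0 < ε → ∃ (η : ℝ) (T : ℕ), 0 < η ∧
      ∀ (m n : ℕ) (f : Z m n → ℝ) (𝒴 : Set (EuclideanSpace ℝ (Fin n))),
        NonconvexConcave f 𝒴 ℓ L D →
        ∀ xhat : EuclideanSpace ℝ (Fin m),
          IsMoreauStationary ℓ (primal f 𝒴) ε xhat →
          ∀ y₀ ∈ 𝒴,
            let A := extragradient 𝒴 ℓ xhat η (C * ε) T (mk xhat y₀)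
            let O : ℕ → Z m n → Z m n := fun _ z => ∇ f z
            (A.calls O : ℝ) ≤ C / ε ^ 2 ∧
            (A.output O).snd ∈ 𝒴 ∧
            IsStationaryPair f 𝒴 ℓ (C * ε) (A.output O) := by
  set K := |L| / (2 * ℓ) + |D| + 1 with hK
  have hK0 : 0 < K := by positivity
  set C := 22 * ℓ * K + 1 + |L| + ℓ * |D| + 4 with hC
  have hC0 : 0 < C := by positivity
  -- With `r = K ε` and `T ≥ 1 / ε²` the budget `T r²` is at least `K²`, which strictly exceeds the
  -- initial squared distance thanks to the `1` in `K`.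
  refine ⟨C, hC0, fun ε hε => ⟨1 / (6 * ℓ), if 1 ≤ ε then 0 else ⌈1 / ε ^ 2⌉₊, by positivity, ?_⟩⟩
  intro m n f 𝒴 h xhat hxhat y₀ hy₀
  have hCL : |L| ≤ C := by rw [hC]; have : 0 ≤ 22 * ℓ * K + ℓ * |D| := by positivity
                           linarith
  have hCD : ℓ * |D| ≤ C := by rw [hC]; have : 0 ≤ 22 * ℓ * K + |L| := by positivity
                               linarith
  split_ifs with h1
  · simp only [extragradient, FirstOrder.calls, FirstOrder.output, FirstOrder.runFrom]
    refine ⟨by rw [Nat.cast_zero]; positivity, hy₀, ?_⟩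
    have : C ≤ C * ε := le_mul_of_one_le_right hC0.le h1
    exact isStationaryPair_start h hℓ (hCL.trans this) (hCD.trans this) xhat hy₀
  · rw [not_le] at h1
    obtain ⟨x, y, hs⟩ := exists_isSaddle h hℓ xhat
    have hd := sq_norm_start_sub_le h hℓ hs.mem hs.grad hy₀ hs.mem
    have hT : 1 / ε ^ 2 ≤ (⌈1 / ε ^ 2⌉₊ : ℝ) := Nat.le_ceil _
    have hT' : (⌈1 / ε ^ 2⌉₊ : ℝ) < 1 / ε ^ 2 + 1 := Nat.ceil_lt_add_one (by positivity)
    have hε2 : ε ^ 2 ≤ 1 := pow_le_one₀ hε.le h1.le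
    have hr := extragradient_run h hℓ hs (ε := ε) (r := K * ε) (δ := C * ε) (by positivity)
      ((hs.isMoreauStationary_iff h hℓ).1 hxhat)
      (by
        have : 0 ≤ (|L| + ℓ * |D| + 4) * ε := by positivity
        rw [hC]; linarith)
      ⌈1 / ε ^ 2⌉₊ (mk xhat y₀) 0
      (by
        have e1 : K ^ 2 ≤ (⌈1 / ε ^ 2⌉₊ : ℝ) * (K * ε) ^ 2 := by
          calc K ^ 2 = 1 / ε ^ 2 * (K * ε) ^ 2 := by field_simp
            _ ≤ _ := by gcongr
        have e2 : 0 ≤ |L| / (2 * ℓ) := by positivity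
        have e3 := abs_nonneg D
        refine lt_of_le_of_lt hd (lt_of_lt_of_le ?_ e1)
        rw [hK]
        nlinarith [mul_nonneg e2 e3])
    refine ⟨?_, hr.2⟩
    have hcalls : ((FirstOrder.calls (fun _ z => ∇ f z) (extragradient 𝒴 ℓ xhat (1 / (6 * ℓ))
        (C * ε) ⌈1 / ε ^ 2⌉₊ (mk xhat y₀)) : ℕ) : ℝ) ≤ 2 * (⌈1 / ε ^ 2⌉₊ : ℝ) := by
      have := hr.1
      rw [zero_add] at this
      exact_mod_cast this
    refine hcalls.trans ?_
    -- For `ε < 1` the rounding at most doubles the budget, so there are at most `4 / ε²` calls;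
    -- this is the summand `4` in `C`.
    have e4 : 1 ≤ 1 / ε ^ 2 := by rw [le_div_iff₀ (by positivity)]; linarith
    have e5 : 4 * (1 / ε ^ 2) ≤ C / ε ^ 2 := by
      rw [mul_one_div]
      gcongr
      rw [hC]
      have : 0 ≤ 22 * ℓ * K + |L| + ℓ * |D| := by positivity
      linarith
    linarith

end Extragradient

/-! ### Mirror-prox along a fixed sequence of oracle answers -/

section MirrorProx

variable {m n : ℕ} {f : Z m n → ℝ} {𝒴 : Set (EuclideanSpace ℝ (Fin n))} {ℓ L D : ℝ}

/-- Reverse the sign of the second block. -/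
def flipSnd (a : Z m n) : Z m n := mk a.fst (-a.snd)

theorem norm_flipSnd (a : Z m n) : ‖flipSnd a‖ = ‖a‖ := by
  refine (sq_eq_sq₀ (norm_nonneg _) (norm_nonneg _)).1 ?_
  rw [norm_sq_Z, norm_sq_Z]
  change ‖a.fst‖ ^ 2 + ‖-a.snd‖ ^ 2 = _
  rw [norm_neg]

theorem flipSnd_sub (a b : Z m n) : flipSnd (a - b) = flipSnd a - flipSnd b := by
  refine WithLp.ofLp_injective 2 (Prod.ext rfl ?_)
  change -(a.snd - b.snd) = -a.snd - -b.snd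
  abel

theorem inner_flipSnd (a b : Z m n) : ⟪flipSnd a, b⟫ = ⟪a, flipSnd b⟫ := by
  rw [inner_Z, inner_Z]
  change ⟪a.fst, b.fst⟫ + ⟪-a.snd, b.snd⟫ = ⟪a.fst, b.fst⟫ + ⟪a.snd, -b.snd⟫
  rw [inner_neg_left, inner_neg_right]

theorem continuous_flipSnd : Continuous (flipSnd : Z m n → Z m n) := by
  refine (LipschitzWith.of_dist_le_mul (K := 1) fun a b => ?_).continuous
  rw [dist_eq_norm, dist_eq_norm, ← flipSnd_sub, norm_flipSnd, NNReal.coe_one, one_mul]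

theorem saddleOp_add (xhat : EuclideanSpace ℝ (Fin m)) (w g d : Z m n) :
    saddleOp ℓ xhat w (g + d) = saddleOp ℓ xhat w g + flipSnd d := by
  refine WithLp.ofLp_injective 2 (Prod.ext ?_ ?_)
  · change g.fst + d.fst + (2 * ℓ) • (w.fst - xhat) = g.fst + (2 * ℓ) • (w.fst - xhat) + d.fst
    abel
  · change -(g.snd + d.snd) = -g.snd + -d.snd
    abel

/-- The iterates of mirror-prox. -/
def mpIter (𝒴 : Set (EuclideanSpace ℝ (Fin n))) (ℓ : ℝ) (xhat : EuclideanSpace ℝ (Fin m)) (η : ℝ)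
    (O : ℕ → Z m n → Z m n) (z₀ : Z m n) : ℕ → Z m n
  | 0 => z₀
  | k + 1 =>
    let z := mpIter 𝒴 ℓ xhat η O z₀ k
    let w := step 𝒴 ℓ xhat η z z (O (2 * k) z)
    step 𝒴 ℓ xhat η z w (O (2 * k + 1) w)

/-- The extrapolated points of mirror-prox. -/
def mpPoint (𝒴 : Set (EuclideanSpace ℝ (Fin n))) (ℓ : ℝ) (xhat : EuclideanSpace ℝ (Fin m)) (η : ℝ)
    (O : ℕ → Z m n → Z m n) (z₀ : Z m n) (k : ℕ) : Z m n :=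
  step 𝒴 ℓ xhat η (mpIter 𝒴 ℓ xhat η O z₀ k) (mpIter 𝒴 ℓ xhat η O z₀ k)
    (O (2 * k) (mpIter 𝒴 ℓ xhat η O z₀ k))

theorem mpIter_succ (xhat : EuclideanSpace ℝ (Fin m)) (η : ℝ) (O : ℕ → Z m n → Z m n)
    (z₀ : Z m n) (k : ℕ) : mpIter 𝒴 ℓ xhat η O z₀ (k + 1) =
      step 𝒴 ℓ xhat η (mpIter 𝒴 ℓ xhat η O z₀ k) (mpPoint 𝒴 ℓ xhat η O z₀ k)
        (O (2 * k + 1) (mpPoint 𝒴 ℓ xhat η O z₀ k)) := rfl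

/-- Iteration `k` makes the calls `2 * k` and `2 * k + 1`, so a loop entered at iterate `k` starts
with the call counter at `2 * k`. -/
theorem mirrorProxLoop_run (xhat : EuclideanSpace ℝ (Fin m)) (η c : ℝ) (O : ℕ → Z m n → Z m n)
    (z₀ : Z m n) (T k : ℕ) (s : Z m n) :
    (mirrorProxLoop 𝒴 ℓ xhat η c T (mpIter 𝒴 ℓ xhat η O z₀ k) s).runFrom O (2 * k) =
      (c • (s + ∑ i ∈ Finset.range T, mpPoint 𝒴 ℓ xhat η O z₀ (k + i)), 2 * (k + T)) := by
  induction T generalizing k s with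
  | zero => simp [mirrorProxLoop, FirstOrder.runFrom]
  | succ T ih =>
    simp only [mirrorProxLoop, FirstOrder.runFrom]
    have := ih (k + 1) (s + mpPoint 𝒴 ℓ xhat η O z₀ k)
    rw [mpIter_succ] at this
    refine this.trans ?_
    rw [Finset.sum_range_succ', add_zero, add_assoc s, add_comm (mpPoint _ _ _ _ _ _ k)]
    simp only [add_assoc, add_comm 1]

theorem mirrorProx_run (xhat : EuclideanSpace ℝ (Fin m)) (η : ℝ) (O : ℕ → Z m n → Z m n)
    (z₀ : Z m n) {T : ℕ} (hT : T ≠ 0) :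
    (mirrorProx 𝒴 ℓ xhat η T z₀).runFrom O 0 =
      ((1 / (T : ℝ)) • ∑ i ∈ Finset.range T, mpPoint 𝒴 ℓ xhat η O z₀ i, 2 * T) := by
  have := mirrorProxLoop_run (𝒴 := 𝒴) (ℓ := ℓ) xhat η (1 / (T : ℝ)) O z₀ T 0 0
  simp only [zero_add] at this
  rw [mirrorProx, if_neg hT]
  exact this

/-- One iteration of mirror-prox with inexact gradients. -/
theorem mirrorProx_descent (h : NonconvexConcave f 𝒴 ℓ L D) (hℓ : 0 < ℓ)
    (xhat : EuclideanSpace ℝ (Fin m)) {η : ℝ} (hη : 0 < η) (hη' : η ≤ 1 / (6 * ℓ))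
    (z g g' : Z m n) {u : Z m n} (hu : u.snd ∈ 𝒴) :
    let w := step 𝒴 ℓ xhat η z z g
    2 * η * (reg f ℓ xhat w.fst u.snd - reg f ℓ xhat u.fst w.snd) ≤
      ‖z - u‖ ^ 2 - ‖step 𝒴 ℓ xhat η z w g' - u‖ ^ 2 -
        2 * η * ⟪g' - ∇ f w, flipSnd (w - u)⟫ +
        3 * η ^ 2 * (‖g' - ∇ f w‖ ^ 2 + ‖g - ∇ f z‖ ^ 2) := by
  intro w
  have h1 := extragradient_inequality
    (inner_step_le h xhat η z z g (step_snd_mem h xhat η z w g'))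
    (inner_step_le h xhat η z w g' hu)
  change _ ≤ ‖z - u‖ ^ 2 - 2 * η * ⟪_, w - u⟫ - ‖w - z‖ ^ 2 + _ at h1
  have h2 := le_inner_saddleOp h xhat w u
  have h3 : ⟪saddleOp ℓ xhat w g', w - u⟫ =
      ⟪saddleOp ℓ xhat w (∇ f w), w - u⟫ + ⟪g' - ∇ f w, flipSnd (w - u)⟫ := by
    rw [← inner_flipSnd, ← inner_add_left, ← saddleOp_add, add_sub_cancel]
  have h4 := norm_saddleOp_sub_le hℓ xhat w z g' g
  have h5 : ‖g' - g‖ ≤ ‖g' - ∇ f w‖ + ℓ * ‖w - z‖ + ‖g - ∇ f z‖ := by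
    have e : g' - g = (g' - ∇ f w) + (∇ f w - ∇ f z) - (g - ∇ f z) := by abel
    rw [e]
    refine (norm_sub_le _ _).trans (add_le_add ((norm_add_le _ _).trans ?_) le_rfl)
    exact add_le_add le_rfl (h.smooth.2 w z)
  have h6 : ‖saddleOp ℓ xhat w g' - saddleOp ℓ xhat z g‖ ^ 2 ≤
      3 * ((3 * ℓ * ‖w - z‖) ^ 2 + ‖g' - ∇ f w‖ ^ 2 + ‖g - ∇ f z‖ ^ 2) := by
    set a := 3 * ℓ * ‖w - z‖
    set b := ‖g' - ∇ f w‖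
    set c := ‖g - ∇ f z‖
    refine (pow_le_pow_left₀ (norm_nonneg _) (by linarith : _ ≤ a + b + c) 2).trans ?_
    nlinarith [sq_nonneg (a - b), sq_nonneg (a - c), sq_nonneg (b - c)]
  have h7 := mul_le_mul_of_nonneg_left h6 (sq_nonneg η)
  have h8 : (6 * ℓ * η) ^ 2 ≤ 1 := by
    refine pow_le_one₀ (by positivity) ?_
    rwa [le_div_iff₀' (by positivity)] at hη'
  -- Here `27 ℓ² η² ≤ 27 / 36`, so the term `-‖w - z‖²` of the extragradient inequality pays for the
  -- variation of the operator.
  have h9 : η ^ 2 * (3 * (3 * ℓ * ‖w - z‖) ^ 2) ≤ ‖w - z‖ ^ 2 := by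
    have := mul_le_mul_of_nonneg_right h8 (sq_nonneg ‖w - z‖)
    have := sq_nonneg (η * ℓ * ‖w - z‖)
    nlinarith
  have h10 := mul_le_mul_of_nonneg_left h2 (by positivity : 0 ≤ 2 * η)
  have h11 : 0 ≤ 2 * η * (ℓ / 2 * ‖w.fst - u.fst‖ ^ 2) := by positivity
  rw [h3] at h1
  linarith

theorem average_snd_mem (hcv : Convex ℝ 𝒴) {T : ℕ} (hT : T ≠ 0) {w : ℕ → Z m n}
    (hw : ∀ i, (w i).snd ∈ 𝒴) : ((1 / (T : ℝ)) • ∑ i ∈ Finset.range T, w i).snd ∈ 𝒴 := by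
  have e : ((1 / (T : ℝ)) • ∑ i ∈ Finset.range T, w i).snd =
      ∑ i ∈ Finset.range T, (1 / (T : ℝ)) • (w i).snd := by
    have := map_sum (WithLp.sndₗ 2 ℝ (EuclideanSpace ℝ (Fin m)) (EuclideanSpace ℝ (Fin n))) w
      (Finset.range T)
    rw [← Finset.smul_sum, WithLp.smul_snd]
    exact congrArg _ this
  rw [e]
  have hT0 : (T : ℝ) ≠ 0 := Nat.cast_ne_zero.2 hT
  refine hcv.sum_mem (fun _ _ => by positivity) ?_ fun i _ => hw i
  rw [Finset.sum_const, Finset.card_range, nsmul_eq_mul, mul_one_div_cancel hT0]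

/-- Jensen's inequality for the convex-concave regularized objective. -/
theorem reg_average_le (h : NonconvexConcave f 𝒴 ℓ L D) (hℓ : 0 < ℓ)
    (xhat : EuclideanSpace ℝ (Fin m)) {T : ℕ} (hT : T ≠ 0) (w : ℕ → Z m n) (u : Z m n) :
    let v := (1 / (T : ℝ)) • ∑ i ∈ Finset.range T, w i
    T * (reg f ℓ xhat v.fst u.snd - reg f ℓ xhat u.fst v.snd) ≤
      ∑ i ∈ Finset.range T, (reg f ℓ xhat (w i).fst u.snd - reg f ℓ xhat u.fst (w i).snd) := by
  intro v
  have hT0 : (T : ℝ) ≠ 0 := Nat.cast_ne_zero.2 hT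
  -- `c` is the gradient of the gap in its first argument at the average `v`; the linear terms sum
  -- to zero because `v` is the mean of the `w i`.
  set c : Z m n := mk (regGradX f ℓ xhat v.fst u.snd) (-gradY f (mk u.fst v.snd))
  have h1 : ∀ i ∈ Finset.range T, (reg f ℓ xhat v.fst u.snd - reg f ℓ xhat u.fst v.snd) +
      ⟪c, w i - v⟫ ≤ reg f ℓ xhat (w i).fst u.snd - reg f ℓ xhat u.fst (w i).snd := by
    intro i _
    have a1 := reg_lower h.smooth xhat v.fst (w i).fst u.snd
    have a2 := reg_concave_upper (ℓ := ℓ) h.smooth.1 (h.concave u.fst) xhat v.snd (w i).snd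
    have a3 : ⟪c, w i - v⟫ = ⟪regGradX f ℓ xhat v.fst u.snd, (w i).fst - v.fst⟫ -
        ⟪gradY f (mk u.fst v.snd), (w i).snd - v.snd⟫ := by
      rw [inner_Z]
      change _ + ⟪-gradY f (mk u.fst v.snd), (w i).snd - v.snd⟫ = _
      rw [inner_neg_left, ← sub_eq_add_neg]
      rfl
    have a4 : 0 ≤ ℓ / 2 * ‖(w i).fst - v.fst‖ ^ 2 := by positivity
    linarith
  have h2 := Finset.sum_le_sum h1
  rw [Finset.sum_add_distrib, Finset.sum_const, Finset.card_range, nsmul_eq_mul,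
    ← inner_sum, Finset.sum_sub_distrib, Finset.sum_const, Finset.card_range] at h2
  have h3 : ∑ i ∈ Finset.range T, w i - T • v = 0 := by
    rw [← Nat.cast_smul_eq_nsmul ℝ, smul_smul, mul_one_div_cancel hT0, one_smul, sub_self]
  rwa [h3, inner_zero_right, add_zero] at h2

/-- The bound on the duality gap in terms of the errors `e (2 * i)` and `e (2 * i + 1)` of the
gradients at the iterates and at the extrapolated points `w i`. -/
def gapBound (η Rsq : ℝ) (T : ℕ) (z₀ : Z m n) (w : ℕ → Z m n) (e : ℕ → Z m n) : ℝ :=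
  (2 * Rsq - 2 * η * ∑ i ∈ Finset.range T, ⟪flipSnd (w i - z₀), e (2 * i + 1)⟫ +
    η ^ 2 * ‖∑ i ∈ Finset.range T, e (2 * i + 1)‖ ^ 2 +
    3 * η ^ 2 * ∑ i ∈ Finset.range T, (‖e (2 * i + 1)‖ ^ 2 + ‖e (2 * i)‖ ^ 2)) / (2 * η * T)

/-- The point at which mirror-prox makes its `j`-th oracle call. -/
def mpQuery (𝒴 : Set (EuclideanSpace ℝ (Fin n))) (ℓ : ℝ) (xhat : EuclideanSpace ℝ (Fin m)) (η : ℝ)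
    (O : ℕ → Z m n → Z m n) (z₀ : Z m n) (j : ℕ) : Z m n :=
  if Even j then mpIter 𝒴 ℓ xhat η O z₀ (j / 2) else mpPoint 𝒴 ℓ xhat η O z₀ (j / 2)

/-- The error of the oracle answers along the trajectory. -/
def mpError (f : Z m n → ℝ) (𝒴 : Set (EuclideanSpace ℝ (Fin n))) (ℓ : ℝ)
    (xhat : EuclideanSpace ℝ (Fin m)) (η : ℝ) (O : ℕ → Z m n → Z m n) (z₀ : Z m n) (j : ℕ) :
    Z m n :=
  O j (mpQuery 𝒴 ℓ xhat η O z₀ j) - ∇ f (mpQuery 𝒴 ℓ xhat η O z₀ j)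

theorem mpQuery_even (xhat : EuclideanSpace ℝ (Fin m)) (η : ℝ) (O : ℕ → Z m n → Z m n)
    (z₀ : Z m n) (k : ℕ) :
    mpQuery 𝒴 ℓ xhat η O z₀ (2 * k) = mpIter 𝒴 ℓ xhat η O z₀ k := by
  simp [mpQuery]

theorem mpQuery_odd (xhat : EuclideanSpace ℝ (Fin m)) (η : ℝ) (O : ℕ → Z m n → Z m n)
    (z₀ : Z m n) (k : ℕ) :
    mpQuery 𝒴 ℓ xhat η O z₀ (2 * k + 1) = mpPoint 𝒴 ℓ xhat η O z₀ k := by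
  have : (2 * k + 1) / 2 = k := by lia
  simp [mpQuery, this]

theorem mpError_even (xhat : EuclideanSpace ℝ (Fin m)) (η : ℝ) (O : ℕ → Z m n → Z m n)
    (z₀ : Z m n) (k : ℕ) : mpError f 𝒴 ℓ xhat η O z₀ (2 * k) =
      O (2 * k) (mpIter 𝒴 ℓ xhat η O z₀ k) - ∇ f (mpIter 𝒴 ℓ xhat η O z₀ k) := by
  rw [mpError, mpQuery_even]

theorem mpError_odd (xhat : EuclideanSpace ℝ (Fin m)) (η : ℝ) (O : ℕ → Z m n → Z m n)
    (z₀ : Z m n) (k : ℕ) : mpError f 𝒴 ℓ xhat η O z₀ (2 * k + 1) =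
      O (2 * k + 1) (mpPoint 𝒴 ℓ xhat η O z₀ k) - ∇ f (mpPoint 𝒴 ℓ xhat η O z₀ k) := by
  rw [mpError, mpQuery_odd]

/-- The comparison point `u` will depend on the random output, so the noise paired with `w i - u`
need not have mean zero. Splitting at `z₀` leaves a part `w i - z₀` fixed before the error is drawn,
and a part `z₀ - u` that meets only the total error; the bound is thus uniform in `u`. -/
theorem gap_le_gapBound (h : NonconvexConcave f 𝒴 ℓ L D) (hℓ : 0 < ℓ)
    (xhat : EuclideanSpace ℝ (Fin m)) {η : ℝ} (hη : 0 < η) (hη' : η ≤ 1 / (6 * ℓ))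
    (O : ℕ → Z m n → Z m n) (z₀ : Z m n) {T : ℕ} (hT : T ≠ 0) {u : Z m n} (hu : u.snd ∈ 𝒴)
    {Rsq : ℝ} (hR : ‖z₀ - u‖ ^ 2 ≤ Rsq) :
    let v := (1 / (T : ℝ)) • ∑ i ∈ Finset.range T, mpPoint 𝒴 ℓ xhat η O z₀ i
    reg f ℓ xhat v.fst u.snd - reg f ℓ xhat u.fst v.snd ≤
      gapBound η Rsq T z₀ (mpPoint 𝒴 ℓ xhat η O z₀) (mpError f 𝒴 ℓ xhat η O z₀) := by
  intro v
  set z := mpIter 𝒴 ℓ xhat η O z₀ with hz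
  set w := mpPoint 𝒴 ℓ xhat η O z₀ with hw
  set e := mpError f 𝒴 ℓ xhat η O z₀ with he
  have hTpos : (0 : ℝ) < T := by positivity
  have h1 : ∀ i ∈ Finset.range T,
      2 * η * (reg f ℓ xhat (w i).fst u.snd - reg f ℓ xhat u.fst (w i).snd) ≤
      -(‖z (i + 1) - u‖ ^ 2 - ‖z i - u‖ ^ 2) -
        2 * η * (⟪flipSnd (w i - z₀), e (2 * i + 1)⟫ + ⟪flipSnd (z₀ - u), e (2 * i + 1)⟫) +
        3 * η ^ 2 * (‖e (2 * i + 1)‖ ^ 2 + ‖e (2 * i)‖ ^ 2) := by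
    intro i _
    have a := mirrorProx_descent h hℓ xhat hη hη' (z i) (O (2 * i) (z i))
      (O (2 * i + 1) (w i)) hu
    change 2 * η * (reg f ℓ xhat (w i).fst u.snd - reg f ℓ xhat u.fst (w i).snd) ≤
      ‖z i - u‖ ^ 2 - ‖z (i + 1) - u‖ ^ 2 -
      2 * η * ⟪O (2 * i + 1) (w i) - ∇ f (w i), flipSnd (w i - u)⟫ +
      3 * η ^ 2 * (‖O (2 * i + 1) (w i) - ∇ f (w i)‖ ^ 2 + ‖O (2 * i) (z i) - ∇ f (z i)‖ ^ 2) at a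
    rw [he, mpError_odd, mpError_even, ← hz, ← hw, ← inner_add_left]
    have b : flipSnd (w i - z₀) + flipSnd (z₀ - u) = flipSnd (w i - u) := by
      simp only [flipSnd_sub]; abel
    rw [b, real_inner_comm]
    linarith
  have h2 := Finset.sum_le_sum h1
  rw [Finset.sum_add_distrib, Finset.sum_sub_distrib, Finset.sum_neg_distrib,
    Finset.sum_range_sub (fun i => ‖z i - u‖ ^ 2), ← Finset.mul_sum, ← Finset.mul_sum,
    ← Finset.mul_sum, Finset.sum_add_distrib, ← inner_sum] at h2
  have h3 := reg_average_le h hℓ xhat hT w u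
  have h4 := mul_le_mul_of_nonneg_left h3 (by positivity : 0 ≤ 2 * η)
  set S := ∑ i ∈ Finset.range T, e (2 * i + 1) with hS
  -- Young's inequality separates `u` from the noise. Its extra `‖z₀ - u‖²` accounts for the `2 *
  -- Rsq` in `gapBound`.
  have h5 : -(2 * η * ⟪flipSnd (z₀ - u), S⟫) ≤ ‖z₀ - u‖ ^ 2 + η ^ 2 * ‖S‖ ^ 2 := by
    have : 0 ≤ ‖flipSnd (z₀ - u) + η • S‖ ^ 2 := by positivity
    rw [norm_add_sq_real, norm_flipSnd, real_inner_smul_right, norm_smul, mul_pow,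
      Real.norm_eq_abs, sq_abs] at this
    linarith
  have h6 : z 0 = z₀ := rfl
  have h7 : 0 ≤ ‖z T - u‖ ^ 2 := by positivity
  rw [h6] at h2
  rw [gapBound, le_div_iff₀ (by positivity), ← hS]
  change 2 * η * (T * (reg f ℓ xhat v.fst u.snd - reg f ℓ xhat u.fst v.snd)) ≤ _ at h4
  linarith

/-- A point with a small duality gap is nearly stationary. -/
theorem stationarity_of_gap (h : NonconvexConcave f 𝒴 ℓ L D) (hℓ : 0 < ℓ)
    {xhat x : EuclideanSpace ℝ (Fin m)} {y y₀ : EuclideanSpace ℝ (Fin n)}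
    (hs : IsSaddle f 𝒴 ℓ xhat x y) {ε b : ℝ} (hx : 2 * ℓ * ‖x - xhat‖ ≤ ε) (hy₀ : y₀ ∈ 𝒴)
    {v : Z m n} (hv : v.snd ∈ 𝒴)
    (hgap : ∀ u : Z m n, u.snd ∈ 𝒴 →
      ‖mk xhat y₀ - u‖ ^ 2 ≤ (|L| / (2 * ℓ)) ^ 2 + |D| ^ 2 →
      reg f ℓ xhat v.fst u.snd - reg f ℓ xhat u.fst v.snd ≤ b) :
    ‖gradX f v‖ ^ 2 ≤ 78 * ℓ * b + 3 * ε ^ 2 ∧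
      ‖gradMap 𝒴 ℓ v.snd (gradY f v)‖ ^ 2 ≤ 2 / ℓ * b := by
  -- Two comparison points are used. The best response `x'` to `v.snd` with the projected ascent
  -- step `p` controls the `y`-measure and `‖v.fst - x'‖`; the saddle point controls `‖v.fst - x‖`.
  obtain ⟨x', hx'⟩ := exists_regGradX_eq_zero hℓ h.smooth xhat v.snd
  set p := proj 𝒴 (v.snd + (1 / ℓ) • gradY f v) with hp
  have hpm : p ∈ 𝒴 := (proj_spec h.nonempty h.closed h.convex _).1
  have h1 := hgap (mk x' p) hpm (sq_norm_start_sub_le h hℓ hv hx' hy₀ hpm)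
  have h2 := hgap (mk x y) hs.mem (sq_norm_start_sub_le h hℓ hs.mem hs.grad hy₀ hs.mem)
  change reg f ℓ xhat v.fst p - reg f ℓ xhat x' v.snd ≤ b at h1
  change reg f ℓ xhat v.fst y - reg f ℓ xhat x v.snd ≤ b at h2
  have h3 := reg_lower h.smooth xhat x' v.fst v.snd
  rw [hx', inner_zero_left] at h3
  have h4 := reg_lower h.smooth xhat x v.fst y
  rw [hs.grad, inner_zero_left] at h4
  have h5 : reg f ℓ xhat x v.snd ≤ reg f ℓ xhat x y := by
    have := hs.le _ hv
    rw [reg, reg]; linarith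
  -- Sufficient increase: a projected ascent step of size `1 / ℓ` gains at least `ℓ / 2` times its
  -- squared length.
  have h6 : ℓ / 2 * ‖gradMap 𝒴 ℓ v.snd (gradY f v)‖ ^ 2 ≤
      reg f ℓ xhat v.fst p - reg f ℓ xhat v.fst v.snd := by
    have a1 := smooth_lower_snd h.smooth v.fst v.snd p
    have a2 := inner_gradient_proj_step_le h hℓ v.snd (gradY f v) hv
    have a3 : v.snd - p = -gradMap 𝒴 ℓ v.snd (gradY f v) := by rw [gradMap, ← hp]; abel
    rw [← hp, a3, inner_neg_right, inner_neg_right, real_inner_self_eq_norm_sq] at a2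
    have a4 : p - v.snd = gradMap 𝒴 ℓ v.snd (gradY f v) := rfl
    rw [a4] at a1
    change f v + ⟪gradY f v, _⟫ - _ ≤ _ at a1
    change _ ≤ f (mk v.fst p) + _ - (f v + _)
    linarith
  have h7 : 0 ≤ ℓ / 2 * ‖gradMap 𝒴 ℓ v.snd (gradY f v)‖ ^ 2 := by positivity
  have h8 : 0 ≤ ℓ / 2 * ‖v.fst - x'‖ ^ 2 := by positivity
  have hdiv : ∀ t : ℝ, ℓ / 2 * t ≤ b → t ≤ 2 / ℓ * b := by
    intro t ht
    rw [div_mul_eq_mul_div, le_div_iff₀ hℓ]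
    linarith
  have k1 : ℓ * ‖v.fst - x'‖ ^ 2 ≤ 2 * b := by linarith
  have k2 : ℓ * ‖v.fst - x‖ ^ 2 ≤ 2 * b := by
    have : 0 ≤ ℓ / 2 * ‖v.fst - x‖ ^ 2 := by positivity
    linarith
  refine ⟨?_, hdiv _ (by linarith)⟩
  have e : gradX f v = (gradX f v - gradX f (mk x' v.snd)) + (2 * ℓ) • (v.fst - x')
      - (2 * ℓ) • (v.fst - x) - (2 * ℓ) • (x - xhat) := by
    have : gradX f (mk x' v.snd) = -((2 * ℓ) • (x' - xhat)) := eq_neg_of_add_eq_zero_left hx'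
    rw [this]
    module
  have n1 : ‖gradX f v - gradX f (mk x' v.snd)‖ ≤ ℓ * ‖v.fst - x'‖ := by
    have a := gradX_sub_le h.smooth v (mk x' v.snd)
    have b : v - mk x' v.snd = mk (v.fst - x') 0 := by
      rw [sub_eq_iff_eq_add', ← mk_add_fst, add_sub_cancel]
      rfl
    rwa [b, norm_mk_fst] at a
  have n2 : ∀ d : EuclideanSpace ℝ (Fin m), ‖(2 * ℓ) • d‖ = 2 * ℓ * ‖d‖ := fun d => by
    rw [norm_smul, Real.norm_of_nonneg (by positivity)]
  have n3 : ‖gradX f v‖ ≤ 3 * ℓ * ‖v.fst - x'‖ + 2 * ℓ * ‖v.fst - x‖ + ε := by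
    rw [e]
    refine (norm_sub_le _ _).trans ?_
    have m1 := norm_sub_le ((gradX f v - gradX f (mk x' v.snd)) + (2 * ℓ) • (v.fst - x'))
      ((2 * ℓ) • (v.fst - x))
    have m2 := norm_add_le (gradX f v - gradX f (mk x' v.snd)) ((2 * ℓ) • (v.fst - x'))
    rw [n2] at m1 m2 ⊢
    linarith
  refine (pow_le_pow_left₀ (norm_nonneg _) n3 2).trans ?_
  set a := ‖v.fst - x'‖
  set c := ‖v.fst - x‖
  -- `(3 ℓ a + 2 ℓ c + ε)² ≤ 3 (9 ℓ² a² + 4 ℓ² c² + ε²)`, and `ℓ a²`, `ℓ c²` are at most `2 b`;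
  -- hence `78 = 3 (18 + 8)`.
  have q1 := mul_le_mul_of_nonneg_left k1 hℓ.le
  have q2 := mul_le_mul_of_nonneg_left k2 hℓ.le
  nlinarith [sq_nonneg (3 * ℓ * a - 2 * ℓ * c), sq_nonneg (3 * ℓ * a - ε),
    sq_nonneg (2 * ℓ * c - ε)]

end MirrorProx

/-! ### Stochastic oracles queried at points that depend on the past -/

section Past

variable {Ξ Ω : Type*} [MeasurableSpace Ξ]

/-- The σ-algebra generated by the samples before time `j`. -/
abbrev pastSigma (ξ : ℕ → Ω → Ξ) (j : ℕ) : MeasurableSpace Ω :=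
  ⨆ i ∈ Set.Iio j, MeasurableSpace.comap (ξ i) inferInstance

theorem pastSigma_mono (ξ : ℕ → Ω → Ξ) {i j : ℕ} (hij : i ≤ j) :
    pastSigma ξ i ≤ pastSigma ξ j :=
  biSup_mono fun _ hk => lt_of_lt_of_le hk hij

theorem measurable_sample (ξ : ℕ → Ω → Ξ) (j : ℕ) : Measurable[pastSigma ξ (j + 1)] (ξ j) :=
  Measurable.mono (comap_measurable (ξ j))
    (le_iSup₂_of_le j (Set.mem_Iio.2 j.lt_succ_self) le_rfl) le_rfl

end Past

section Noise

variable {m n : ℕ} {f : Z m n → ℝ} {𝒴 : Set (EuclideanSpace ℝ (Fin n))} {ℓ L D σ : ℝ}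
  {Ξ : Type*} [MeasurableSpace Ξ] {ν : Measure Ξ}
  {Ω : Type*} [mΩ : MeasurableSpace Ω] {μ : Measure Ω}
  {G : Z m n → Ξ → Z m n}

theorem measurable_oracle_error (hc : Continuous (∇ f)) (hG : IsStochasticOracle ν f σ G) :
    Measurable fun p : Z m n × Ξ => G p.1 p.2 - ∇ f p.1 :=
  hG.measurable.sub (hc.measurable.comp measurable_fst)

/-- The query point is independent of the fresh sample, so their joint law is a product and Fubini
reduces the bound to a fixed point. -/
theorem oracle_error_sq [IsProbabilityMeasure ν] [IsProbabilityMeasure μ]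
    (hc : Continuous (∇ f)) (hG : IsStochasticOracle ν f σ G)
    {W : Ω → Z m n} {s : Ω → Ξ} (hW : Measurable W) (hs : Measurable s)
    (hind : IndepFun W s μ) (hlaw : μ.map s = ν) :
    Integrable (fun ω => ‖G (W ω) (s ω) - ∇ f (W ω)‖ ^ 2) μ ∧
      ∫ ω, ‖G (W ω) (s ω) - ∇ f (W ω)‖ ^ 2 ∂μ ≤ σ ^ 2 := by
  have hmap := (indepFun_iff_map_prod_eq_prod_map_map hW.aemeasurable hs.aemeasurable).1 hind
  rw [hlaw] at hmap
  have hprob : IsProbabilityMeasure (μ.map W) := Measure.isProbabilityMeasure_map hW.aemeasurable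
  set F : Z m n × Ξ → ℝ := fun p => ‖G p.1 p.2 - ∇ f p.1‖ ^ 2 with hF
  have hFm : Measurable F := (measurable_oracle_error hc hG).norm.pow_const 2
  have hint : Integrable F ((μ.map W).prod ν) := by
    rw [integrable_prod_iff hFm.aestronglyMeasurable]
    refine ⟨ae_of_all _ fun w => hG.integrable_sq w, ?_⟩
    refine (integrable_const (σ ^ 2)).mono'
      hFm.norm.stronglyMeasurable.integral_prod_right.aestronglyMeasurable (ae_of_all _ fun w => ?_)
    rw [Real.norm_of_nonneg (integral_nonneg fun _ => norm_nonneg _)]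
    refine le_trans (le_of_eq (integral_congr_ae (ae_of_all _ fun t => ?_))) (hG.variance_le w)
    exact Real.norm_of_nonneg (sq_nonneg _)
  have hpair : Measurable fun ω => (W ω, s ω) := hW.prodMk hs
  constructor
  · rw [← hmap] at hint
    exact (integrable_map_measure hFm.aestronglyMeasurable hpair.aemeasurable).1 hint
  · have e : ∫ ω, ‖G (W ω) (s ω) - ∇ f (W ω)‖ ^ 2 ∂μ = ∫ p, F p ∂((μ.map W).prod ν) := by
      rw [← hmap, integral_map hpair.aemeasurable hFm.aestronglyMeasurable]
    rw [e, integral_prod _ hint]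
    calc ∫ w, ∫ t, F (w, t) ∂ν ∂(μ.map W) ≤ ∫ _, σ ^ 2 ∂(μ.map W) :=
          integral_mono hint.integral_prod_left (integrable_const _) fun w => hG.variance_le w
      _ = σ ^ 2 := by simp

theorem integrable_inner_of_memLp {X Y : Ω → Z m n} (hX : MemLp X 2 μ) (hY : MemLp Y 2 μ) :
    Integrable (fun ω => ⟪X ω, Y ω⟫) μ := by
  have h1 := (memLp_two_iff_integrable_sq_norm hX.1).1 hX
  have h2 := (memLp_two_iff_integrable_sq_norm hY.1).1 hY
  refine (h1.add h2).mono' (hX.1.inner hY.1) (ae_of_all _ fun ω => ?_)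
  have := abs_real_inner_le_norm (X ω) (Y ω)
  change |⟪X ω, Y ω⟫| ≤ ‖X ω‖ ^ 2 + ‖Y ω‖ ^ 2
  nlinarith [sq_nonneg (‖X ω‖ - ‖Y ω‖), sq_nonneg ‖X ω‖, sq_nonneg ‖Y ω‖]

/-- Fubini again: with `W` and `X` frozen, the inner integral vanishes by unbiasedness. This needs
the pair, not just each component, to be independent of the sample. -/
theorem integral_inner_oracle_error [IsProbabilityMeasure ν] [IsProbabilityMeasure μ]
    (hc : Continuous (∇ f)) (hG : IsStochasticOracle ν f σ G)
    {W X : Ω → Z m n} {s : Ω → Ξ} (hW : Measurable W) (hX : Measurable X) (hs : Measurable s)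
    (hind : IndepFun (fun ω => (W ω, X ω)) s μ) (hlaw : μ.map s = ν)
    (hint : Integrable (fun ω => ⟪X ω, G (W ω) (s ω) - ∇ f (W ω)⟫) μ) :
    ∫ ω, ⟪X ω, G (W ω) (s ω) - ∇ f (W ω)⟫ ∂μ = 0 := by
  have hWX : Measurable fun ω => (W ω, X ω) := hW.prodMk hX
  have hmap := (indepFun_iff_map_prod_eq_prod_map_map hWX.aemeasurable hs.aemeasurable).1 hind
  rw [hlaw] at hmap
  have hprob : IsProbabilityMeasure (μ.map fun ω => (W ω, X ω)) :=
    Measure.isProbabilityMeasure_map hWX.aemeasurable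
  set F : (Z m n × Z m n) × Ξ → ℝ := fun p => ⟪p.1.2, G p.1.1 p.2 - ∇ f p.1.1⟫ with hF
  have hFm : Measurable F := (measurable_snd.comp measurable_fst).inner
    ((measurable_oracle_error hc hG).comp
      ((measurable_fst.comp measurable_fst).prodMk measurable_snd))
  have hpair : Measurable fun ω => ((W ω, X ω), s ω) := hWX.prodMk hs
  have hintF : Integrable F ((μ.map fun ω => (W ω, X ω)).prod ν) := by
    rw [← hmap]
    exact (integrable_map_measure hFm.aestronglyMeasurable hpair.aemeasurable).2 hint
  have e : ∫ ω, ⟪X ω, G (W ω) (s ω) - ∇ f (W ω)⟫ ∂μ =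
      ∫ p, F p ∂((μ.map fun ω => (W ω, X ω)).prod ν) := by
    rw [← hmap, integral_map hpair.aemeasurable hFm.aestronglyMeasurable]
  rw [e, integral_prod _ hintF]
  refine integral_eq_zero_of_ae (ae_of_all _ fun p => ?_)
  change ∫ t, ⟪p.2, G p.1 t - ∇ f p.1⟫ ∂ν = 0
  rw [integral_inner (hG.integrable p.1), hG.unbiased, inner_zero_right]

theorem pastSigma_le {ξ : ℕ → Ω → Ξ} (hξ : ∀ k, Measurable (ξ k)) (j : ℕ) :
    pastSigma ξ j ≤ mΩ :=
  iSup₂_le fun i _ => (hξ i).comap_le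

theorem indepFun_of_pastSigma {ξ : ℕ → Ω → Ξ} (hξ : ∀ k, Measurable (ξ k))
    (hind : iIndepFun ξ μ) {j : ℕ} {β : Type*} [MeasurableSpace β] {V : Ω → β}
    (hV : Measurable[pastSigma ξ j] V) : IndepFun V (ξ j) μ := by
  have h := indep_iSup_of_disjoint (fun i => (hξ i).comap_le) hind.iIndep
    (S := Set.Iio j) (T := {j}) (by simp)
  rw [IndepFun_iff_Indep]
  refine indep_of_indep_of_le_left (indep_of_indep_of_le_right h ?_) hV.comap_le
  exact le_iSup₂_of_le (f := fun i (_ : i ∈ ({j} : Set ℕ)) =>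
    MeasurableSpace.comap (ξ i) inferInstance) j rfl le_rfl

end Noise

/-! ### Measurability and integrability of the mirror-prox iterates -/

section Iterates

variable {m n : ℕ} {f : Z m n → ℝ} {𝒴 : Set (EuclideanSpace ℝ (Fin n))} {ℓ L D σ : ℝ}
  {Ξ : Type*} [MeasurableSpace Ξ] {ν : Measure Ξ}
  {Ω : Type*} {G : Z m n → Ξ → Z m n}

theorem continuous_step (h : NonconvexConcave f 𝒴 ℓ L D) (xhat : EuclideanSpace ℝ (Fin m))
    (η : ℝ) : Continuous fun p : Z m n × Z m n × Z m n => step 𝒴 ℓ xhat η p.1 p.2.1 p.2.2 := by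
  have c : Continuous (WithLp.ofLp : Z m n → _) := WithLp.prod_continuous_ofLp 2 _ _
  have c1 := c.comp (continuous_fst (X := Z m n) (Y := Z m n × Z m n))
  have c2 := c.comp ((continuous_fst (X := Z m n) (Y := Z m n)).comp
    (continuous_snd (X := Z m n) (Y := Z m n × Z m n)))
  have c3 := c.comp ((continuous_snd (X := Z m n) (Y := Z m n)).comp
    (continuous_snd (X := Z m n) (Y := Z m n × Z m n)))
  have h1 := (continuous_fst.comp c1).sub
    (((continuous_fst.comp c3).add (((continuous_fst.comp c2).sub
      (continuous_const (y := xhat))).const_smul (2 * ℓ))).const_smul η)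
  have h2 := (continuous_proj h.nonempty h.closed h.convex).comp
    ((continuous_snd.comp c1).add ((continuous_snd.comp c3).const_smul η))
  exact (WithLp.prod_continuous_toLp 2 _ _).comp (h1.prodMk h2)

theorem measurable_step_comp (h : NonconvexConcave f 𝒴 ℓ L D) (xhat : EuclideanSpace ℝ (Fin m))
    (η : ℝ) {α : Type*} [MeasurableSpace α] {z w g : α → Z m n} (hz : Measurable z)
    (hw : Measurable w) (hg : Measurable g) :
    Measurable fun a => step 𝒴 ℓ xhat η (z a) (w a) (g a) :=
  (continuous_step h xhat η).measurable.comp (hz.prodMk (hw.prodMk hg))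

variable {ξ : ℕ → Ω → Ξ}

/-- Each half-iteration consumes one sample, so the filtration index agrees with the number of calls
made. -/
theorem measurable_mpPoint_of_mpIter (h : NonconvexConcave f 𝒴 ℓ L D)
    (hG : IsStochasticOracle ν f σ G) (xhat : EuclideanSpace ℝ (Fin m)) (η : ℝ) (z₀ : Z m n)
    {k : ℕ} (hz : Measurable[pastSigma ξ (2 * k)] fun ω =>
      mpIter 𝒴 ℓ xhat η (fun j z => G z (ξ j ω)) z₀ k) :
    Measurable[pastSigma ξ (2 * k + 1)] fun ω =>
      mpPoint 𝒴 ℓ xhat η (fun j z => G z (ξ j ω)) z₀ k := by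
  have hz' := hz.mono (pastSigma_mono ξ (Nat.le_succ (2 * k))) le_rfl
  let := pastSigma ξ (2 * k + 1)
  exact measurable_step_comp h xhat η hz' hz'
    (hG.measurable.comp (hz'.prodMk (measurable_sample ξ (2 * k))))

theorem measurable_mpIter (h : NonconvexConcave f 𝒴 ℓ L D)
    (hG : IsStochasticOracle ν f σ G) (xhat : EuclideanSpace ℝ (Fin m)) (η : ℝ) (z₀ : Z m n)
    (k : ℕ) : Measurable[pastSigma ξ (2 * k)] fun ω =>
      mpIter 𝒴 ℓ xhat η (fun j z => G z (ξ j ω)) z₀ k := by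
  induction k with
  | zero => exact @measurable_const _ _ _ (pastSigma ξ (2 * 0)) z₀
  | succ k ih =>
    have hle : pastSigma ξ (2 * k + 1) ≤ pastSigma ξ (2 * (k + 1)) := pastSigma_mono ξ (by lia)
    have hw := (measurable_mpPoint_of_mpIter h hG xhat η z₀ ih).mono hle le_rfl
    have hz := ih.mono (pastSigma_mono ξ (by lia : 2 * k ≤ 2 * (k + 1))) le_rfl
    have hs : Measurable[pastSigma ξ (2 * (k + 1))] (ξ (2 * k + 1)) :=
      measurable_sample ξ (2 * k + 1)
    let := pastSigma ξ (2 * (k + 1))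
    exact measurable_step_comp h xhat η hz hw (hG.measurable.comp (hw.prodMk hs))

theorem measurable_mpQuery (h : NonconvexConcave f 𝒴 ℓ L D)
    (hG : IsStochasticOracle ν f σ G) (xhat : EuclideanSpace ℝ (Fin m)) (η : ℝ) (z₀ : Z m n)
    (j : ℕ) : Measurable[pastSigma ξ j] fun ω =>
      mpQuery 𝒴 ℓ xhat η (fun j z => G z (ξ j ω)) z₀ j := by
  rcases Nat.even_or_odd' j with ⟨k, rfl | rfl⟩
  · simp only [mpQuery_even]
    exact measurable_mpIter h hG xhat η z₀ k
  · simp only [mpQuery_odd]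
    exact measurable_mpPoint_of_mpIter h hG xhat η z₀ (measurable_mpIter h hG xhat η z₀ k)

theorem measurable_mpError (h : NonconvexConcave f 𝒴 ℓ L D) (hℓ : 0 < ℓ)
    (hG : IsStochasticOracle ν f σ G) (xhat : EuclideanSpace ℝ (Fin m)) (η : ℝ) (z₀ : Z m n)
    (j : ℕ) : Measurable[pastSigma ξ (j + 1)] fun ω =>
      mpError f 𝒴 ℓ xhat η (fun j z => G z (ξ j ω)) z₀ j := by
  have hq := (measurable_mpQuery (ξ := ξ) h hG xhat η z₀ j).mono
    (pastSigma_mono ξ (Nat.le_succ j)) le_rfl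
  let := pastSigma ξ (j + 1)
  exact (measurable_oracle_error (continuous_gradient hℓ h.smooth) hG).comp
    (hq.prodMk (measurable_sample ξ j))

variable [mΩ : MeasurableSpace Ω] {μ : Measure Ω} [IsProbabilityMeasure μ]

/-- The `x` block is affine in the data and the `y` block stays in a bounded set. Square
integrability of the iterates makes their pairings with the errors integrable. -/
theorem memLp_step (h : NonconvexConcave f 𝒴 ℓ L D) (hℓ : 0 < ℓ)
    (xhat : EuclideanSpace ℝ (Fin m)) {η : ℝ} (hη : 0 < η) {z w g : Ω → Z m n}
    (hz : MemLp z 2 μ) (hw : MemLp w 2 μ) (hg : MemLp g 2 μ)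
    (hm : Measurable fun ω => step 𝒴 ℓ xhat η (z ω) (w ω) (g ω)) :
    MemLp (fun ω => step 𝒴 ℓ xhat η (z ω) (w ω) (g ω)) 2 μ := by
  obtain ⟨y₀, hy₀⟩ := h.nonempty
  have hB : MemLp (fun ω => (‖z ω‖ + η * (‖g ω‖ + 2 * ℓ * (‖w ω‖ + ‖xhat‖))) +
      (‖y₀‖ + |D|)) 2 μ :=
    (hz.norm.add ((hg.norm.add ((hw.norm.add (memLp_const _)).const_mul (2 * ℓ))).const_mul
      η)).add (memLp_const _)
  refine hB.mono' hm.aestronglyMeasurable (ae_of_all _ fun ω => ?_)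
  refine (norm_le_add _).trans (add_le_add ?_ ?_)
  · change ‖(z ω).fst - η • ((g ω).fst + (2 * ℓ) • ((w ω).fst - xhat))‖ ≤ _
    refine (norm_sub_le _ _).trans (add_le_add (norm_fst_le _) ?_)
    rw [norm_smul, Real.norm_of_nonneg hη.le]
    gcongr
    refine (norm_add_le _ _).trans (add_le_add (norm_fst_le _) ?_)
    rw [norm_smul, Real.norm_of_nonneg (by positivity)]
    gcongr
    exact (norm_sub_le _ _).trans (add_le_add (norm_fst_le _) le_rfl)
  · have h1 := norm_sub_le_of_mem h (step_snd_mem h xhat η (z ω) (w ω) (g ω)) hy₀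
    have h2 := norm_le_norm_add_norm_sub' (step 𝒴 ℓ xhat η (z ω) (w ω) (g ω)).snd y₀
    linarith

theorem memLp_gradient (hℓ : 0 < ℓ) (hf : IsSmooth ℓ f) {W : Ω → Z m n} (hW : MemLp W 2 μ) :
    MemLp (fun ω => ∇ f (W ω)) 2 μ := by
  have hB : MemLp (fun ω => ‖∇ f 0‖ + ℓ * ‖W ω‖) 2 μ :=
    (memLp_const ‖∇ f 0‖).add (hW.norm.const_mul ℓ)
  have hm : AEStronglyMeasurable (fun ω => ∇ f (W ω)) μ :=
    (continuous_gradient hℓ hf).comp_aestronglyMeasurable hW.1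
  refine hB.mono' hm (ae_of_all _ fun ω => ?_)
  have h1 := hf.2 (W ω) 0
  rw [sub_zero] at h1
  have h2 := norm_le_norm_add_norm_sub' (∇ f (W ω)) (∇ f 0)
  linarith

variable [IsProbabilityMeasure ν]

theorem mpError_sq (h : NonconvexConcave f 𝒴 ℓ L D) (hℓ : 0 < ℓ)
    (hG : IsStochasticOracle ν f σ G) (hξ : ∀ k, Measurable (ξ k)) (hind : iIndepFun ξ μ)
    (hlaw : ∀ k, μ.map (ξ k) = ν) (xhat : EuclideanSpace ℝ (Fin m)) (η : ℝ) (z₀ : Z m n)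
    (j : ℕ) :
    Integrable (fun ω => ‖mpError f 𝒴 ℓ xhat η (fun j z => G z (ξ j ω)) z₀ j‖ ^ 2) μ ∧
      ∫ ω, ‖mpError f 𝒴 ℓ xhat η (fun j z => G z (ξ j ω)) z₀ j‖ ^ 2 ∂μ ≤ σ ^ 2 :=
  have hq := measurable_mpQuery (ξ := ξ) h hG xhat η z₀ j
  oracle_error_sq (continuous_gradient hℓ h.smooth) hG (hq.mono (pastSigma_le hξ j) le_rfl)
    (hξ j) (indepFun_of_pastSigma hξ hind hq) (hlaw j)

theorem memLp_mpError (h : NonconvexConcave f 𝒴 ℓ L D) (hℓ : 0 < ℓ)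
    (hG : IsStochasticOracle ν f σ G) (hξ : ∀ k, Measurable (ξ k)) (hind : iIndepFun ξ μ)
    (hlaw : ∀ k, μ.map (ξ k) = ν) (xhat : EuclideanSpace ℝ (Fin m)) (η : ℝ) (z₀ : Z m n)
    (j : ℕ) : MemLp (fun ω => mpError f 𝒴 ℓ xhat η (fun j z => G z (ξ j ω)) z₀ j) 2 μ :=
  (memLp_two_iff_integrable_sq_norm ((measurable_mpError h hℓ hG xhat η z₀ j).mono
    (pastSigma_le hξ _) le_rfl).aestronglyMeasurable).2
    (mpError_sq h hℓ hG hξ hind hlaw xhat η z₀ j).1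

/-- The errors are orthogonal to the past. -/
theorem integral_inner_mpError (h : NonconvexConcave f 𝒴 ℓ L D) (hℓ : 0 < ℓ)
    (hG : IsStochasticOracle ν f σ G) (hξ : ∀ k, Measurable (ξ k)) (hind : iIndepFun ξ μ)
    (hlaw : ∀ k, μ.map (ξ k) = ν) (xhat : EuclideanSpace ℝ (Fin m)) (η : ℝ) (z₀ : Z m n)
    (j : ℕ) {X : Ω → Z m n} (hX : Measurable[pastSigma ξ j] X) (hX2 : MemLp X 2 μ) :
    Integrable (fun ω => ⟪X ω, mpError f 𝒴 ℓ xhat η (fun j z => G z (ξ j ω)) z₀ j⟫) μ ∧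
      ∫ ω, ⟪X ω, mpError f 𝒴 ℓ xhat η (fun j z => G z (ξ j ω)) z₀ j⟫ ∂μ = 0 := by
  have hint := integrable_inner_of_memLp hX2 (memLp_mpError h hℓ hG hξ hind hlaw xhat η z₀ j)
  have hq := measurable_mpQuery (ξ := ξ) h hG xhat η z₀ j
  have hle := pastSigma_le hξ j
  exact ⟨hint, integral_inner_oracle_error (continuous_gradient hℓ h.smooth) hG
    (hq.mono hle le_rfl) (hX.mono hle le_rfl) (hξ j)
    (indepFun_of_pastSigma hξ hind (hq.prodMk hX)) (hlaw j) hint⟩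

theorem memLp_oracle_answer (h : NonconvexConcave f 𝒴 ℓ L D) (hℓ : 0 < ℓ)
    (hG : IsStochasticOracle ν f σ G) (hξ : ∀ k, Measurable (ξ k)) (hind : iIndepFun ξ μ)
    (hlaw : ∀ k, μ.map (ξ k) = ν) (xhat : EuclideanSpace ℝ (Fin m)) (η : ℝ) (z₀ : Z m n)
    {j : ℕ} (hq : MemLp (fun ω => mpQuery 𝒴 ℓ xhat η (fun j z => G z (ξ j ω)) z₀ j) 2 μ) :
    MemLp (fun ω => G (mpQuery 𝒴 ℓ xhat η (fun j z => G z (ξ j ω)) z₀ j) (ξ j ω)) 2 μ := by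
  refine ((memLp_mpError h hℓ hG hξ hind hlaw xhat η z₀ j).add
    (memLp_gradient hℓ h.smooth hq)).ae_eq (ae_of_all _ fun ω => ?_)
  exact sub_add_cancel _ _

theorem memLp_mpPoint_of_mpIter (h : NonconvexConcave f 𝒴 ℓ L D) (hℓ : 0 < ℓ)
    (hG : IsStochasticOracle ν f σ G) (hξ : ∀ k, Measurable (ξ k)) (hind : iIndepFun ξ μ)
    (hlaw : ∀ k, μ.map (ξ k) = ν) (xhat : EuclideanSpace ℝ (Fin m)) {η : ℝ} (hη : 0 < η)
    (z₀ : Z m n) {k : ℕ}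
    (hz : MemLp (fun ω => mpIter 𝒴 ℓ xhat η (fun j z => G z (ξ j ω)) z₀ k) 2 μ) :
    MemLp (fun ω => mpPoint 𝒴 ℓ xhat η (fun j z => G z (ξ j ω)) z₀ k) 2 μ := by
  have hg := memLp_oracle_answer h hℓ hG hξ hind hlaw xhat η z₀ (j := 2 * k)
    (by simpa only [mpQuery_even] using hz)
  simp only [mpQuery_even] at hg
  exact memLp_step h hℓ xhat hη hz hz hg ((measurable_mpPoint_of_mpIter h hG xhat η z₀
    (measurable_mpIter h hG xhat η z₀ k)).mono (pastSigma_le hξ _) le_rfl)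

theorem memLp_mpIter (h : NonconvexConcave f 𝒴 ℓ L D) (hℓ : 0 < ℓ)
    (hG : IsStochasticOracle ν f σ G) (hξ : ∀ k, Measurable (ξ k)) (hind : iIndepFun ξ μ)
    (hlaw : ∀ k, μ.map (ξ k) = ν) (xhat : EuclideanSpace ℝ (Fin m)) {η : ℝ} (hη : 0 < η)
    (z₀ : Z m n) (k : ℕ) :
    MemLp (fun ω => mpIter 𝒴 ℓ xhat η (fun j z => G z (ξ j ω)) z₀ k) 2 μ := by
  induction k with
  | zero => exact memLp_const z₀
  | succ k ih =>
    have hw := memLp_mpPoint_of_mpIter h hℓ hG hξ hind hlaw xhat hη z₀ ih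
    have hg := memLp_oracle_answer h hℓ hG hξ hind hlaw xhat η z₀ (j := 2 * k + 1)
      (by simpa only [mpQuery_odd] using hw)
    simp only [mpQuery_odd] at hg
    exact memLp_step h hℓ xhat hη ih hw hg
      ((measurable_mpIter h hG xhat η z₀ (k + 1)).mono (pastSigma_le hξ _) le_rfl)

end Iterates

/-! ### Stochastic mirror-prox -/

section Stochastic

variable {m n : ℕ} {f : Z m n → ℝ} {𝒴 : Set (EuclideanSpace ℝ (Fin n))} {ℓ L D σ : ℝ}
  {Ξ : Type*} [MeasurableSpace Ξ] {ν : Measure Ξ} [IsProbabilityMeasure ν]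
  {Ω : Type*} [mΩ : MeasurableSpace Ω] {μ : Measure Ω} [IsProbabilityMeasure μ]
  {G : Z m n → Ξ → Z m n} {ξ : ℕ → Ω → Ξ}

/-- The errors at the extrapolated points are pairwise uncorrelated. -/
theorem sum_mpError_sq (h : NonconvexConcave f 𝒴 ℓ L D) (hℓ : 0 < ℓ)
    (hG : IsStochasticOracle ν f σ G) (hξ : ∀ k, Measurable (ξ k)) (hind : iIndepFun ξ μ)
    (hlaw : ∀ k, μ.map (ξ k) = ν) (xhat : EuclideanSpace ℝ (Fin m)) (η : ℝ) (z₀ : Z m n)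
    (T : ℕ) :
    Integrable (fun ω => ‖∑ i ∈ Finset.range T,
      mpError f 𝒴 ℓ xhat η (fun j z => G z (ξ j ω)) z₀ (2 * i + 1)‖ ^ 2) μ ∧
    ∫ ω, ‖∑ i ∈ Finset.range T,
      mpError f 𝒴 ℓ xhat η (fun j z => G z (ξ j ω)) z₀ (2 * i + 1)‖ ^ 2 ∂μ ≤ T * σ ^ 2 := by
  set e : ℕ → Ω → Z m n := fun j ω => mpError f 𝒴 ℓ xhat η (fun j z => G z (ξ j ω)) z₀ j with he
  induction T with
  | zero => simp
  | succ T ih =>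
    -- The earlier errors depend only on samples drawn before call `2 * T + 1`, so the cross term
    -- with the new error integrates to zero.
    have hm : Measurable[pastSigma ξ (2 * T + 1)] fun ω =>
        ∑ i ∈ Finset.range T, e (2 * i + 1) ω := by
      refine Finset.measurable_sum (m := pastSigma ξ (2 * T + 1)) _ fun i hi => ?_
      have := Finset.mem_range.1 hi
      exact (measurable_mpError h hℓ hG xhat η z₀ (2 * i + 1)).mono
        (pastSigma_mono ξ (by lia)) le_rfl
    have hL : MemLp (fun ω => ∑ i ∈ Finset.range T, e (2 * i + 1) ω) 2 μ :=
      memLp_finsetSum _ fun i _ => memLp_mpError h hℓ hG hξ hind hlaw xhat η z₀ (2 * i + 1)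
    have h1 := integral_inner_mpError h hℓ hG hξ hind hlaw xhat η z₀ (2 * T + 1) hm hL
    have h2 := mpError_sq h hℓ hG hξ hind hlaw xhat η z₀ (2 * T + 1)
    have e1 : ∀ ω, ‖∑ i ∈ Finset.range (T + 1), e (2 * i + 1) ω‖ ^ 2 =
        ‖∑ i ∈ Finset.range T, e (2 * i + 1) ω‖ ^ 2 +
          2 * ⟪∑ i ∈ Finset.range T, e (2 * i + 1) ω, e (2 * T + 1) ω⟫ +
          ‖e (2 * T + 1) ω‖ ^ 2 := by
      intro ω
      rw [Finset.sum_range_succ, norm_add_sq_real]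
    have i1 := ih.1.add (h1.1.const_mul 2)
    change Integrable (fun ω => ‖∑ i ∈ Finset.range (T + 1), e (2 * i + 1) ω‖ ^ 2) μ ∧
      ∫ ω, ‖∑ i ∈ Finset.range (T + 1), e (2 * i + 1) ω‖ ^ 2 ∂μ ≤ _
    simp only [e1]
    refine ⟨i1.add h2.1, ?_⟩
    have i2 := integral_add i1 h2.1
    have i3 := integral_add ih.1 (h1.1.const_mul 2)
    simp only [Pi.add_apply] at i2 i3
    rw [integral_const_mul, h1.2] at i3
    refine i2.le.trans ?_
    rw [i3]
    push_cast
    linarith [ih.2, h2.2]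

/-- The pairing with `w i - z₀` has mean zero, the total error contributes `η² T σ²` and the `2 T`
individual errors `6 η² T σ²`. Dividing `7 η² T σ²` by `2 η T` gives the noise term. -/
theorem integral_gapBound_le (h : NonconvexConcave f 𝒴 ℓ L D) (hℓ : 0 < ℓ)
    (hG : IsStochasticOracle ν f σ G) (hξ : ∀ k, Measurable (ξ k)) (hind : iIndepFun ξ μ)
    (hlaw : ∀ k, μ.map (ξ k) = ν) (xhat : EuclideanSpace ℝ (Fin m)) {η : ℝ} (hη : 0 < η)
    (z₀ : Z m n) (Rsq : ℝ) {T : ℕ} (hT : T ≠ 0) :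
    Integrable (fun ω => gapBound η Rsq T z₀ (mpPoint 𝒴 ℓ xhat η (fun j z => G z (ξ j ω)) z₀)
      (mpError f 𝒴 ℓ xhat η (fun j z => G z (ξ j ω)) z₀)) μ ∧
    ∫ ω, gapBound η Rsq T z₀ (mpPoint 𝒴 ℓ xhat η (fun j z => G z (ξ j ω)) z₀)
      (mpError f 𝒴 ℓ xhat η (fun j z => G z (ξ j ω)) z₀) ∂μ ≤
        Rsq / (η * T) + 7 / 2 * η * σ ^ 2 := by
  set e : ℕ → Ω → Z m n := fun j ω => mpError f 𝒴 ℓ xhat η (fun j z => G z (ξ j ω)) z₀ j with he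
  set w : ℕ → Ω → Z m n := fun k ω => mpPoint 𝒴 ℓ xhat η (fun j z => G z (ξ j ω)) z₀ k with hw
  have hM : ∀ i ∈ Finset.range T,
      Integrable (fun ω => ⟪flipSnd (w i ω - z₀), e (2 * i + 1) ω⟫) μ ∧
      ∫ ω, ⟪flipSnd (w i ω - z₀), e (2 * i + 1) ω⟫ ∂μ = 0 := by
    intro i _
    have m1 : Measurable[pastSigma ξ (2 * i + 1)] (w i) :=
      measurable_mpPoint_of_mpIter h hG xhat η z₀ (measurable_mpIter h hG xhat η z₀ i)
    have m2 : Measurable[pastSigma ξ (2 * i + 1)] fun ω => flipSnd (w i ω - z₀) :=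
      (continuous_flipSnd.comp (continuous_id.sub continuous_const)).measurable.comp m1
    have m3 : MemLp (w i) 2 μ := memLp_mpPoint_of_mpIter h hℓ hG hξ hind hlaw xhat hη z₀
      (memLp_mpIter h hℓ hG hξ hind hlaw xhat hη z₀ i)
    have m4 : MemLp (fun ω => flipSnd (w i ω - z₀)) 2 μ := by
      refine (m3.sub (memLp_const z₀)).of_le
        (m2.mono (pastSigma_le hξ _) le_rfl).aestronglyMeasurable (ae_of_all _ fun ω => ?_)
      rw [norm_flipSnd]
      rfl
    exact integral_inner_mpError h hℓ hG hξ hind hlaw xhat η z₀ (2 * i + 1) m2 m4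
  have hE : ∀ j, Integrable (fun ω => ‖e j ω‖ ^ 2) μ ∧ ∫ ω, ‖e j ω‖ ^ 2 ∂μ ≤ σ ^ 2 :=
    mpError_sq h hℓ hG hξ hind hlaw xhat η z₀
  have hS : Integrable (fun ω => ‖∑ i ∈ Finset.range T, e (2 * i + 1) ω‖ ^ 2) μ ∧
      ∫ ω, ‖∑ i ∈ Finset.range T, e (2 * i + 1) ω‖ ^ 2 ∂μ ≤ T * σ ^ 2 :=
    sum_mpError_sq h hℓ hG hξ hind hlaw xhat η z₀ T
  have hMi := integrable_finsetSum _ fun i hi => (hM i hi).1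
  have hMz : ∫ ω, ∑ i ∈ Finset.range T, ⟪flipSnd (w i ω - z₀), e (2 * i + 1) ω⟫ ∂μ = 0 := by
    rw [integral_finsetSum _ fun i hi => (hM i hi).1]
    exact Finset.sum_eq_zero fun i hi => (hM i hi).2
  have hVe : ∀ i ∈ Finset.range T,
      Integrable (fun ω => ‖e (2 * i + 1) ω‖ ^ 2 + ‖e (2 * i) ω‖ ^ 2) μ :=
    fun i _ => (hE (2 * i + 1)).1.add (hE (2 * i)).1
  have hVi := integrable_finsetSum (Finset.range T) hVe
  have hVz : ∫ ω, ∑ i ∈ Finset.range T, (‖e (2 * i + 1) ω‖ ^ 2 + ‖e (2 * i) ω‖ ^ 2) ∂μ ≤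
      T * (2 * σ ^ 2) := by
    rw [integral_finsetSum _ hVe]
    refine (Finset.sum_le_card_nsmul _ _ (2 * σ ^ 2) fun i _ => ?_).trans (by simp)
    rw [integral_add (hE (2 * i + 1)).1 (hE (2 * i)).1]
    linarith [(hE (2 * i + 1)).2, (hE (2 * i)).2]
  have j1 := (integrable_const (μ := μ) (2 * Rsq)).sub (hMi.const_mul (2 * η))
  have j2 := j1.add (hS.1.const_mul (η ^ 2))
  have j3 := j2.add (hVi.const_mul (3 * η ^ 2))
  have hint := j3.div_const (2 * η * T)
  refine ⟨hint, ?_⟩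
  change ∫ ω, (2 * Rsq - 2 * η * ∑ i ∈ Finset.range T, ⟪flipSnd (w i ω - z₀), e (2 * i + 1) ω⟫ +
    η ^ 2 * ‖∑ i ∈ Finset.range T, e (2 * i + 1) ω‖ ^ 2 +
    3 * η ^ 2 * ∑ i ∈ Finset.range T, (‖e (2 * i + 1) ω‖ ^ 2 + ‖e (2 * i) ω‖ ^ 2)) /
      (2 * η * T) ∂μ ≤ _
  have k1 := integral_sub (integrable_const (μ := μ) (2 * Rsq)) (hMi.const_mul (2 * η))
  have k2 := integral_add j1 (hS.1.const_mul (η ^ 2))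
  have k3 := integral_add j2 (hVi.const_mul (3 * η ^ 2))
  simp only [Pi.add_apply, Pi.sub_apply] at k1 k2 k3
  rw [integral_div, k3, k2, k1, integral_const, probReal_univ, one_smul, integral_const_mul,
    integral_const_mul, integral_const_mul, hMz]
  have hTpos : (0 : ℝ) < T := by positivity
  rw [div_le_iff₀ (by positivity)]
  have l1 : (Rsq / (η * T) + 7 / 2 * η * σ ^ 2) * (2 * η * T) =
      2 * Rsq + 7 * η ^ 2 * (T * σ ^ 2) := by field_simp
  rw [l1]
  have l2 := mul_le_mul_of_nonneg_left hS.2 (sq_nonneg η)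
  have l3 := mul_le_mul_of_nonneg_left hVz (by positivity : 0 ≤ 3 * η ^ 2)
  linarith

theorem continuous_gradX (hℓ : 0 < ℓ) (hf : IsSmooth ℓ f) : Continuous (gradX f) := by
  refine (LipschitzWith.of_dist_le_mul (K := ⟨ℓ, hℓ.le⟩) fun z z' => ?_).continuous
  rw [dist_eq_norm, dist_eq_norm]
  exact gradX_sub_le hf z z'

theorem continuous_gradMap (h : NonconvexConcave f 𝒴 ℓ L D) (hℓ : 0 < ℓ) :
    Continuous fun z : Z m n => gradMap 𝒴 ℓ z.snd (gradY f z) := by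
  have hs : Continuous fun z : Z m n => z.snd :=
    continuous_snd.comp (WithLp.prod_continuous_ofLp 2 _ _)
  have hy : Continuous (gradY f) := hs.comp (continuous_gradient hℓ h.smooth)
  exact ((continuous_proj h.nonempty h.closed h.convex).comp
    (hs.add (hy.const_smul (1 / ℓ)))).sub hs

/-- The expected squared stationarity measures of the output of stochastic mirror-prox. -/
theorem mirrorProx_mean_square (h : NonconvexConcave f 𝒴 ℓ L D) (hℓ : 0 < ℓ)
    (hG : IsStochasticOracle ν f σ G) (hξ : ∀ k, Measurable (ξ k)) (hind : iIndepFun ξ μ)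
    (hlaw : ∀ k, μ.map (ξ k) = ν) {xhat : EuclideanSpace ℝ (Fin m)} {η : ℝ} (hη : 0 < η)
    (hη' : η ≤ 1 / (6 * ℓ)) {ε : ℝ} (hxhat : IsMoreauStationary ℓ (primal f 𝒴) ε xhat)
    {y₀ : EuclideanSpace ℝ (Fin n)} (hy₀ : y₀ ∈ 𝒴) {T : ℕ} (hT : T ≠ 0) {b : ℝ}
    (hb : ((|L| / (2 * ℓ)) ^ 2 + |D| ^ 2) / (η * T) + 7 / 2 * η * σ ^ 2 ≤ b) :
    let v : Ω → Z m n := fun ω => (1 / (T : ℝ)) • ∑ i ∈ Finset.range T,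
      mpPoint 𝒴 ℓ xhat η (fun j z => G z (ξ j ω)) (mk xhat y₀) i
    Integrable (fun ω => ‖gradX f (v ω)‖ ^ 2) μ ∧
    ∫ ω, ‖gradX f (v ω)‖ ^ 2 ∂μ ≤ 78 * ℓ * b + 3 * ε ^ 2 ∧
    Integrable (fun ω => ‖gradMap 𝒴 ℓ (v ω).snd (gradY f (v ω))‖ ^ 2) μ ∧
    ∫ ω, ‖gradMap 𝒴 ℓ (v ω).snd (gradY f (v ω))‖ ^ 2 ∂μ ≤ 2 / ℓ * b := by
  intro v
  obtain ⟨x, y, hs⟩ := exists_isSaddle h hℓ xhat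
  set Rsq := (|L| / (2 * ℓ)) ^ 2 + |D| ^ 2
  obtain ⟨hB, hBi⟩ :=
    integral_gapBound_le h hℓ hG hξ hind hlaw xhat hη (mk xhat y₀) Rsq hT
  set B : Ω → ℝ := fun ω => gapBound η Rsq T (mk xhat y₀)
    (mpPoint 𝒴 ℓ xhat η (fun j z => G z (ξ j ω)) (mk xhat y₀))
    (mpError f 𝒴 ℓ xhat η (fun j z => G z (ξ j ω)) (mk xhat y₀))
  have hBb : ∫ ω, B ω ∂μ ≤ b := hBi.trans hb
  -- Applied path by path, with comparison points that vary with `ω`; this is where the uniformity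
  -- of `gap_le_gapBound` matters.
  have hst : ∀ ω, ‖gradX f (v ω)‖ ^ 2 ≤ 78 * ℓ * B ω + 3 * ε ^ 2 ∧
      ‖gradMap 𝒴 ℓ (v ω).snd (gradY f (v ω))‖ ^ 2 ≤ 2 / ℓ * B ω := fun ω =>
    stationarity_of_gap h hℓ hs ((hs.isMoreauStationary_iff h hℓ).1 hxhat) hy₀
      (average_snd_mem h.convex hT fun i => step_snd_mem h xhat _ _ _ _)
      fun u hu hR => gap_le_gapBound h hℓ xhat hη hη' _ _ hT hu hR
  have hv : Measurable v := by
    refine (Finset.measurable_sum _ fun i _ => ?_).const_smul (1 / (T : ℝ))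
    exact (measurable_mpPoint_of_mpIter h hG xhat η (mk xhat y₀)
      (measurable_mpIter h hG xhat η (mk xhat y₀) i)).mono (pastSigma_le hξ _) le_rfl
  have hX : Measurable fun ω => ‖gradX f (v ω)‖ ^ 2 :=
    ((continuous_gradX hℓ h.smooth).measurable.comp hv).norm.pow_const 2
  have hY : Measurable fun ω => ‖gradMap 𝒴 ℓ (v ω).snd (gradY f (v ω))‖ ^ 2 :=
    ((continuous_gradMap h hℓ).measurable.comp hv).norm.pow_const 2
  have hBX : Integrable (fun ω => 78 * ℓ * B ω + 3 * ε ^ 2) μ :=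
    (hB.const_mul (78 * ℓ)).add (integrable_const _)
  have hBY : Integrable (fun ω => 2 / ℓ * B ω) μ := hB.const_mul _
  have hXi := hBX.mono' hX.aestronglyMeasurable (ae_of_all _ fun ω => by
    rw [Real.norm_of_nonneg (sq_nonneg _)]
    exact (hst ω).1)
  have hYi := hBY.mono' hY.aestronglyMeasurable (ae_of_all _ fun ω => by
    rw [Real.norm_of_nonneg (sq_nonneg _)]
    exact (hst ω).2)
  refine ⟨hXi, ?_, hYi, ?_⟩
  · refine (integral_mono hXi hBX fun ω => (hst ω).1).trans ?_
    rw [integral_add (hB.const_mul _) (integrable_const _), integral_const_mul, integral_const,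
      probReal_univ, one_smul]
    gcongr
  · refine (integral_mono hYi hBY fun ω => (hst ω).2).trans ?_
    rw [integral_const_mul]
    gcongr

end Stochastic

theorem mirrorProx_complexity (ℓ L D : ℝ) (hℓ : 0 < ℓ) (σ : ℝ) :
    ∃ C : ℝ, 0 < C ∧ ∀ ε : ℝ, 0 < ε → ∃ (η : ℝ) (T : ℕ), 0 < η ∧
      ∀ (m n : ℕ) (f : Z m n → ℝ) (𝒴 : Set (EuclideanSpace ℝ (Fin n))),
        NonconvexConcave f 𝒴 ℓ L D →
        ∀ (Ξ : Type*) [MeasurableSpace Ξ] (ν : Measure Ξ) [IsProbabilityMeasure ν]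
          (G : Z m n → Ξ → Z m n), IsStochasticOracle ν f σ G →
        ∀ (Ω : Type*) [MeasurableSpace Ω] (μ : Measure Ω) [IsProbabilityMeasure μ]
          (ξ : ℕ → Ω → Ξ), (∀ k, Measurable (ξ k)) → iIndepFun ξ μ → (∀ k, μ.map (ξ k) = ν) →
        ∀ xhat : EuclideanSpace ℝ (Fin m),
          IsMoreauStationary ℓ (primal f 𝒴) ε xhat →
          ∀ y₀ ∈ 𝒴,
            let A := mirrorProx 𝒴 ℓ xhat η T (mk xhat y₀)
            let O : Ω → ℕ → Z m n → Z m n := fun ω k z => G z (ξ k ω)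
            (∀ ω, (A.calls (O ω) : ℝ) ≤ C / ε ^ 4 ∧ (A.output (O ω)).snd ∈ 𝒴) ∧
            Integrable (fun ω => ‖gradX f (A.output (O ω))‖ ^ 2) μ ∧
            ∫ ω, ‖gradX f (A.output (O ω))‖ ^ 2 ∂μ ≤ (C * ε) ^ 2 ∧
            Integrable (fun ω => ‖gradMap 𝒴 ℓ (A.output (O ω)).snd
              (gradY f (A.output (O ω)))‖ ^ 2) μ ∧
            ∫ ω, ‖gradMap 𝒴 ℓ (A.output (O ω)).snd
              (gradY f (A.output (O ω)))‖ ^ 2 ∂μ ≤ (C * ε / ℓ) ^ 2 := by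
  set Rsq := (|L| / (2 * ℓ)) ^ 2 + |D| ^ 2 with hRsq
  have hRsq0 : 0 ≤ Rsq := by positivity
  set K := 6 * ℓ * Rsq + σ ^ 2 / ℓ with hK
  have hK0 : 0 ≤ K := by positivity
  set C := 78 * ℓ * K + 4 + |L| + ℓ * |D| with hC
  have hC4 : 4 ≤ C := by
    have : 0 ≤ 78 * ℓ * K + |L| + ℓ * |D| := by positivity
    linarith
  have hCK : 78 * ℓ * K + 3 ≤ C := by
    have : 0 ≤ |L| + ℓ * |D| := by positivity
    linarith
  have hCL : |L| ≤ C := by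
    have : 0 ≤ 78 * ℓ * K + ℓ * |D| := by positivity
    linarith
  have hCD : ℓ * |D| ≤ C := by
    have : 0 ≤ 78 * ℓ * K + |L| := by positivity
    linarith
  have hC0 : 0 < C := by linarith
  -- The mean-square bounds are linear in the constants and the target has `C²`; `C ≥ 4` bridges
  -- this.
  have hCsq : C ≤ C ^ 2 := by nlinarith
  -- `η = ε² / (6 ℓ)` and `T ≥ ε⁻⁴` make both `Rsq / (η T)` and `η σ²` of order `ε²`. For `ε ≥ 1` no
  -- iteration is made and `η` is immaterial.
  refine ⟨C, hC0, fun ε hε => ⟨ε ^ 2 / (6 * ℓ) ⊓ 1 / (6 * ℓ),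
    if 1 ≤ ε then 0 else ⌈1 / ε ^ 4⌉₊, by positivity, ?_⟩⟩
  intro m n f 𝒴 h Ξ _ ν _ G hG Ω _ μ _ ξ hξ hind hlaw xhat hxhat y₀ hy₀
  split_ifs with h1
  · obtain ⟨a1, a2⟩ := isStationaryPair_start h hℓ
      (hCL.trans (le_mul_of_one_le_right hC0.le h1)) (hCD.trans (le_mul_of_one_le_right hC0.le h1))
      xhat hy₀
    simp only [mirrorProx, if_true, FirstOrder.calls, FirstOrder.output, FirstOrder.runFrom,
      integral_const, probReal_univ, one_smul]
    exact ⟨fun _ => ⟨by rw [Nat.cast_zero]; positivity, hy₀⟩, integrable_const _,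
      pow_le_pow_left₀ (norm_nonneg _) a1 2, integrable_const _,
      pow_le_pow_left₀ (norm_nonneg _) a2 2⟩
  · rw [not_le] at h1
    set T := ⌈1 / ε ^ 4⌉₊
    have hT : 1 / ε ^ 4 ≤ (T : ℝ) := Nat.le_ceil _
    have hT' : (T : ℝ) < 1 / ε ^ 4 + 1 := Nat.ceil_lt_add_one (by positivity)
    have hT0 : T ≠ 0 := (Nat.ceil_pos.2 (by positivity)).ne'
    have hε2 : ε ^ 2 ≤ 1 := pow_le_one₀ hε.le h1.le
    have hε4 : ε ^ 4 ≤ 1 := pow_le_one₀ hε.le h1.le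
    have hηeq : ε ^ 2 / (6 * ℓ) ⊓ 1 / (6 * ℓ) = ε ^ 2 / (6 * ℓ) :=
      inf_eq_left.2 (div_le_div_of_nonneg_right hε2 (by positivity))
    rw [hηeq]
    set η := ε ^ 2 / (6 * ℓ) with hη
    have hη0 : 0 < η := by positivity
    have hb : Rsq / (η * T) + 7 / 2 * η * σ ^ 2 ≤ K * ε ^ 2 := by
      have b1 : Rsq / (η * T) ≤ 6 * ℓ * Rsq * ε ^ 2 := by
        rw [div_le_iff₀ (by positivity)]
        have : 6 * ℓ * Rsq * ε ^ 2 * (η * T) = Rsq * (ε ^ 4 * T) := by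
          rw [hη]; field_simp
        rw [this]
        refine le_mul_of_one_le_right hRsq0 ?_
        rwa [div_le_iff₀' (by positivity)] at hT
      have b2 : 7 / 2 * η * σ ^ 2 ≤ σ ^ 2 / ℓ * ε ^ 2 := by
        have : 7 / 2 * η * σ ^ 2 = 7 / 12 * (σ ^ 2 / ℓ * ε ^ 2) := by
          rw [hη]; field_simp; ring
        rw [this]
        have : 0 ≤ σ ^ 2 / ℓ * ε ^ 2 := by positivity
        linarith
      rw [hK]
      linarith
    obtain ⟨c1, c2, c3, c4⟩ := mirrorProx_mean_square h hℓ hG hξ hind hlaw hη0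
      (div_le_div_of_nonneg_right hε2 (by positivity)) hxhat hy₀ hT0 hb
    simp only [FirstOrder.calls, FirstOrder.output, mirrorProx_run _ _ _ _ hT0]
    refine ⟨fun ω => ⟨?_, average_snd_mem h.convex hT0 fun i => step_snd_mem h xhat _ _ _ _⟩,
      c1, c2.trans ?_, c3, c4.trans ?_⟩
    · push_cast
      have e4 : 1 ≤ 1 / ε ^ 4 := by rw [le_div_iff₀ (by positivity)]; linarith
      have e5 : 4 * (1 / ε ^ 4) ≤ C / ε ^ 4 := by
        rw [mul_one_div]
        gcongr
      linarith
    · rw [mul_pow]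
      have := mul_le_mul_of_nonneg_right (hCK.trans hCsq) (sq_nonneg ε)
      linarith
    · have : 2 / ℓ * (K * ε ^ 2) = 2 * ℓ * K * ε ^ 2 / ℓ ^ 2 := by field_simp
      rw [this, div_pow, mul_pow]
      gcongr
      have : 0 ≤ ℓ * K := by positivity
      linarith

end Minimax

end

theorem mainTheorem6 (ℓ L D : ℝ) (hℓ : 0 < ℓ) :
    -- Moreau-envelope stationary point to stationary pair, by extragradient
    (∃ C : ℝ, 0 < C ∧ ∀ ε : ℝ, 0 < ε → ∃ (η : ℝ) (T : ℕ), 0 < η ∧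
      ∀ (m n : ℕ) (f : Minimax.Z m n → ℝ) (𝒴 : Set (EuclideanSpace ℝ (Fin n))),
        Minimax.NonconvexConcave f 𝒴 ℓ L D →
        ∀ xhat : EuclideanSpace ℝ (Fin m),
          Minimax.IsMoreauStationary ℓ (Minimax.primal f 𝒴) ε xhat →
          ∀ y₀ ∈ 𝒴,
            let A := Minimax.extragradient 𝒴 ℓ xhat η (C * ε) T (Minimax.mk xhat y₀)
            let O : ℕ → Minimax.Z m n → Minimax.Z m n := fun _ z => gradient f z
            (A.calls O : ℝ) ≤ C / ε ^ 2 ∧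
            (A.output O).snd ∈ 𝒴 ∧
            Minimax.IsStationaryPair f 𝒴 ℓ (C * ε) (A.output O)) ∧
    -- the same by stochastic mirror-prox, with stochastic gradients
    (∀ σ : ℝ, 0 ≤ σ → ∃ C : ℝ, 0 < C ∧ ∀ ε : ℝ, 0 < ε → ∃ (η : ℝ) (T : ℕ), 0 < η ∧
      ∀ (m n : ℕ) (f : Minimax.Z m n → ℝ) (𝒴 : Set (EuclideanSpace ℝ (Fin n))),
        Minimax.NonconvexConcave f 𝒴 ℓ L D →
        ∀ (Ξ : Type*) [MeasurableSpace Ξ] (ν : Measure Ξ) [IsProbabilityMeasure ν]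
          (G : Minimax.Z m n → Ξ → Minimax.Z m n), Minimax.IsStochasticOracle ν f σ G →
        ∀ (Ω : Type*) [MeasurableSpace Ω] (μ : Measure Ω) [IsProbabilityMeasure μ]
          (ξ : ℕ → Ω → Ξ), (∀ k, Measurable (ξ k)) → iIndepFun ξ μ → (∀ k, μ.map (ξ k) = ν) →
        ∀ xhat : EuclideanSpace ℝ (Fin m),
          Minimax.IsMoreauStationary ℓ (Minimax.primal f 𝒴) ε xhat →
          ∀ y₀ ∈ 𝒴,
            let A := Minimax.mirrorProx 𝒴 ℓ xhat η T (Minimax.mk xhat y₀)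
            let O : Ω → ℕ → Minimax.Z m n → Minimax.Z m n := fun ω k z => G z (ξ k ω)
            (∀ ω, (A.calls (O ω) : ℝ) ≤ C / ε ^ 4 ∧ (A.output (O ω)).snd ∈ 𝒴) ∧
            Integrable (fun ω => ‖Minimax.gradX f (A.output (O ω))‖ ^ 2) μ ∧
            ∫ ω, ‖Minimax.gradX f (A.output (O ω))‖ ^ 2 ∂μ ≤ (C * ε) ^ 2 ∧
            Integrable (fun ω => ‖Minimax.gradMap 𝒴 ℓ (A.output (O ω)).snd
              (Minimax.gradY f (A.output (O ω)))‖ ^ 2) μ ∧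
            ∫ ω, ‖Minimax.gradMap 𝒴 ℓ (A.output (O ω)).snd
              (Minimax.gradY f (A.output (O ω)))‖ ^ 2 ∂μ ≤ (C * ε / ℓ) ^ 2) ∧
    -- stationary pair to Moreau-envelope stationary point
    (∃ C : ℝ, 0 < C ∧ ∀ ε : ℝ, 0 ≤ ε →
      ∀ (m n : ℕ) (f : Minimax.Z m n → ℝ) (𝒴 : Set (EuclideanSpace ℝ (Fin n))),
        Minimax.NonconvexConcave f 𝒴 ℓ L D →
        ∀ (xhat : EuclideanSpace ℝ (Fin m)) (yhat : EuclideanSpace ℝ (Fin n)),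
          Minimax.IsStationaryPair f 𝒴 ℓ (ε ^ 2) (Minimax.mk xhat yhat) →
          Minimax.IsMoreauStationary ℓ (Minimax.primal f 𝒴) (C * ε) xhat) :=
  ⟨Minimax.extragradient_complexity ℓ L D hℓ,
    fun σ _ => Minimax.mirrorProx_complexity ℓ L D hℓ σ,
    4 * |L| + 8 * ℓ * |D| + 1, by positivity, fun _ hε _ _ _ _ h _ _ hst =>
      Minimax.isMoreauStationary_of_isStationaryPair h hℓ hε hst⟩
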